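/- **Network.** A macro base station (eNB), a cache-aided small base station (HeNB) and a cloud serve two users. There is a library of $N\ge 2$ independent, uniformly distributed files $W_1,\dots,W_N$ of $L$ bits each. The channel is $\mathbf n=(n_{d1},n_{d2},n_{d3})$ with integers $n_{d1}\ge 0$, $n_{d2}\ge1$, $n_{d3}\ge 1$; put $q=\max\{n_{d1},n_{d2},n_{d3}\}$ and let $\mathbf S$ be the $q\times q$ down-shift matrix over $\mathbb F_2$. In one channel use the HeNB sends $\mathbf x_1\in\mathbb F_2^q$, the eNB sends $\mathbf x_2\in\mathbb F_2^q$, and users 1 and 2 receive $$\mathbf y_1=\mathbf S^{q-n_{d1}}\mathbf x_1\oplus \mathbf S^{q-n_{d2}}\mathbf x_2,\qquad \mathbf y_2=\mathbf S^{q-n_{d3}}\mathbf x_2 .$$ **Codes.** Before the requests are known, the HeNB stores $\lfloor\mu L\rfloor$ bits $S_i=\phi_i(W_i)$ about each file $W_i$, where $\mu\in[0,1]$. Then user $k$ requests file $W_{d_k}$, $\mathbf d=(d_1,d_2)\in\{1,\dots,N\}^2$. The cloud, which knows all files, first sends $\lfloor n_FT_F\rfloor$ bits to the HeNB in $T_F$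 channel uses of the fronthaul link, whose capacity is a real number $n_F\ge0$ of bits per channel use. After that (serial transmission) the wireless channel is used $T_E$ times; the HeNB encodes its cache and the fronthaul message, the eNB encodes all files, and user $k$ decodes $W_{d_k}$ from its received vectors. Everything may depend on $\mathbf d$, except the cache. A family of codes, one for each $L$, is reliable if for each user and each $\mathbf d$ the error probability tends to $0$ as $L\to\infty$; its delivery time per bit is $\max_{\mathbf d}\limsup_{L\to\infty}(T_F+T_E)/L$. The minimum delivery time per bit (DTB) $\Delta^*_{\rm det}(\mu,n_F,\mathbf n)$ is the infimum of this quantity over all reliable families. **Theorem.** Let $$\Delta'_{\rm LB}(\mathbf n)=\max\Big\{\tfrac1{n_{d3}},\tfrac1{\max\{n_{d1},n_{d2}\}},\tfrac{2}{\max\{n_{d1}+n_{d3},n_{d2}\}}\Big\},\qquad \Delta''_{\rm LB}(\mathbf n)=\max\Big\{\tfrac{1}{n_{d3}-n_{d2}},\Delta'_{\rm LB}(\mathbf n)\Big\}$$ ($\Delta''_{\rm LB}$ is only used with a zero factor when $n_{d3}\le n_{d2}$). For all $\mu\in[0,1]$ and $n_F\ge 0$, $$\Delta^*_{\rm det}(\mu,n_F,\mathbf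 n)=\begin{cases}\max\Big\{\frac{1-\mu}{n_{d2}},\frac{2-\mu}{\max\{n_{d2},n_{d3}\}},\Delta'_{\rm LB}(\mathbf n)\Big\}& n_F\le n_{d2},\\[1mm] \max\Big\{\frac{1-\mu}{n_F}+\big(1-\frac{n_{d2}}{n_F}\big)\Delta''_{\rm LB}(\mathbf n),\frac{2-\mu}{\max\{n_{d2},n_{d3}\}},\Delta'_{\rm LB}(\mathbf n)\Big\}& n_{d2}\le n_F\le\max\{n_{d2},n_{d3}\},\\[1mm] \max\Big\{\frac{2-\mu}{n_F}+\big(1-\frac{\max\{n_{d2},n_{d3}\}}{n_F}\big)\Delta'_{\rm LB}(\mathbf n),\frac{1-\mu}{n_F}+\big(1-\frac{n_{d2}}{n_F}\big)\Delta'_{\rm LB}(\mathbf n),\Delta'_{\rm LB}(\mathbf n)\Big\}& n_F\ge\max\{n_{d2},n_{d3}\}.\end{cases}$$ In the following four classes of channel regimes this specializes as follows. * Class I ($n_{d3}\le n_{d2}\le 2n_{d3}$ and $n_{d1}+n_{d3}\ge n_{d2}$; or $n_{d2}\le n_{d3}\le 2n_{d2}$): $\Delta^*_{\rm det}=\max\{\frac{2-\mu}{\max\{n_{d2},n_{d3}\}},\Delta'_{\rm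 LB}\}$ for $n_F\le\max\{n_{d2},n_{d3}\}$, and $\Delta^*_{\rm det}=\max\{\frac{2-\mu}{n_F}+(1-\frac{\max\{n_{d2},n_{d3}\}}{n_F})\Delta'_{\rm LB},\Delta'_{\rm LB}\}$ for $n_F\ge\max\{n_{d2},n_{d3}\}$. * Class II ($n_{d3}\ge 2n_{d2}$, $\frac1{n_{d3}-n_{d2}}\ge\Delta'_{\rm LB}$, $\frac1{n_{d2}}\ge\Delta'_{\rm LB}$): $\Delta^*_{\rm det}=\max\{\frac{1-\mu}{n_{d2}},\frac{2-\mu}{n_{d3}},\Delta'_{\rm LB}\}$ for $n_F\le n_{d2}$; $\max\{\frac{1-\mu}{n_F}+(1-\frac{n_{d2}}{n_F})\Delta''_{\rm LB},\frac{2-\mu}{n_{d3}},\Delta'_{\rm LB}\}$ for $n_{d2}\le n_F\le n_{d3}$; $\max\{\frac{2-\mu}{n_F}+(1-\frac{n_{d3}}{n_F})\Delta'_{\rm LB},\Delta'_{\rm LB}\}$ for $n_F\ge n_{d3}$. * Class III ($n_{d3}\ge 2n_{d2}$, $\frac1{n_{d3}-n_{d2}}\le\Delta'_{\rm LB}$,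 $\frac1{n_{d2}}\ge\Delta'_{\rm LB}$): $\Delta^*_{\rm det}=\max\{\frac{1-\mu}{n_{d2}},\Delta'_{\rm LB}\}$ for $n_F\le n_{d2}$, and $\max\{\frac{1-\mu}{n_F}+(1-\frac{n_{d2}}{n_F})\Delta'_{\rm LB},\Delta'_{\rm LB}\}$ for $n_F\ge n_{d2}$. * Class IV ($n_{d2}\ge n_{d3}$ and $n_{d2}\ge 2n_{d3}$; or $n_{d1}+n_{d3}\le n_{d2}$; or $n_{d3}\ge 2n_{d2}$ and $\frac1{n_{d2}}\le\Delta'_{\rm LB}$): $\Delta^*_{\rm det}=\Delta'_{\rm LB}$ for all $n_F\ge0$. -/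

import Mathlib

open Filter Topology

namespace HetNet

/-- A bit, with addition modulo two. -/
abbrev Bit : Type := ZMod 2

/-- The wireless channel of the linear deterministic model, in bit levels per channel use:
`d1` for the link HeNB to user 1, `d2` for the (cross) link eNB to user 1, and
`d3` for the link eNB to user 2. The HeNB is not connected to user 2. -/
structure Channel where
  d1 : ℕ
  d2 : ℕ
  d3 : ℕ

/-- The length of the channel input and output vectors. -/
def Channel.q (n : Channel) : ℕ := max n.d1 (max n.d2 n.d3)

/-- The down-shift matrix of size `q`: it has ones exactly on the first sub-diagonal. -/
def downShift (q : ℕ) : Matrix (Fin q) (Fin q) Bit :=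
  Matrix.of fun i j => if (i : ℕ) = (j : ℕ) + 1 then 1 else 0

/-- The output at user 1 in one channel use, for the inputs `x₁` of the HeNB and `x₂` of the eNB. -/
def Channel.out₁ (n : Channel) (x₁ x₂ : Fin n.q → Bit) : Fin n.q → Bit :=
  (downShift n.q ^ (n.q - n.d1)).mulVec x₁ + (downShift n.q ^ (n.q - n.d2)).mulVec x₂

/-- The output at user 2 in one channel use, for the input `x₂` of the eNB. -/
def Channel.out₂ (n : Channel) (x₂ : Fin n.q → Bit) : Fin n.q → Bit :=
  (downShift n.q ^ (n.q - n.d3)).mulVec x₂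

/-- The contents of a library of `N` files of `L` bits each. -/
abbrev Library (N L : ℕ) : Type := Fin N → Fin L → Bit

/-- A demand: user 1 requests the file `d 0` and user 2 requests the file `d 1`. -/
abbrev Demand (N : ℕ) : Type := Fin 2 → Fin N

/-- A caching and serial delivery scheme for `N` files of `L` bits each, fractional cache size `μ`,
and fronthaul capacity `nF` in bits per channel use. -/
structure Code (N : ℕ) (μ nF : ℝ) (n : Channel) (L : ℕ) where
  /-- Placement, before the demand is known: `⌊μ L⌋` bits about every file, without coding across
  files, are stored at the HeNB. -/
  cache : Fin N → (Fin L → Bit) → (Fin ⌊μ * L⌋₊ → Bit)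
  /-- The number of channel uses of the fronthaul phase. -/
  TF : Demand N → ℕ
  /-- The number of channel uses of the wireless phase, which starts when the fronthaul phase has
  ended. -/
  TE : Demand N → ℕ
  /-- The message that the cloud, which knows all files, sends to the HeNB: `⌊nF TF⌋` bits. -/
  fronthaul : (d : Demand N) → Library N L → (Fin ⌊nF * TF d⌋₊ → Bit)
  /-- The HeNB encodes its cache and the message received over the fronthaul. -/
  heNB : (d : Demand N) → (Fin N → Fin ⌊μ * L⌋₊ → Bit) → (Fin ⌊nF * TF d⌋₊ → Bit) →
    (Fin (TE d) → Fin n.q → Bit)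
  /-- The eNB has access to all files. -/
  eNB : (d : Demand N) → Library N L → (Fin (TE d) → Fin n.q → Bit)
  /-- User `k` estimates its file from everything it has received. -/
  decode : (k : Fin 2) → (d : Demand N) → (Fin (TE d) → Fin n.q → Bit) → (Fin L → Bit)

namespace Code

variable {N : ℕ} {μ nF : ℝ} {n : Channel} {L : ℕ}

/-- The signal sent by the HeNB. -/
def x₁ (c : Code N μ nF n L) (d : Demand N) (W : Library N L) : Fin (c.TE d) → Fin n.q → Bit :=
  c.heNB d (fun i => c.cache i (W i)) (c.fronthaul d W)

/-- The signal received by user `k`. -/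
def received (c : Code N μ nF n L) (k : Fin 2) (d : Demand N) (W : Library N L) :
    Fin (c.TE d) → Fin n.q → Bit :=
  fun t => if k = 0 then n.out₁ (c.x₁ d W t) (c.eNB d W t) else n.out₂ (c.eNB d W t)

/-- The probability that user `k` does not recover its file under the demand `d`, for independent
and uniformly distributed files. -/
noncomputable def errorProb (c : Code N μ nF n L) (k : Fin 2) (d : Demand N) : ℝ :=
  ((Finset.univ.filter fun W : Library N L =>
      c.decode k d (c.received k d W) ≠ W (d k)).card : ℝ) / (Fintype.card (Library N L) : ℝ)

end Code

/-- One scheme for each file length `L`. -/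
abbrev Scheme (N : ℕ) (μ nF : ℝ) (n : Channel) : Type := (L : ℕ) → Code N μ nF n L

/-- All error probabilities vanish as the file length grows. -/
def Scheme.Reliable {N : ℕ} {μ nF : ℝ} {n : Channel} (c : Scheme N μ nF n) : Prop :=
  ∀ (k : Fin 2) (d : Demand N), Tendsto (fun L => (c L).errorProb k d) atTop (𝓝 0)

/-- The delivery time per bit of a scheme: the asymptotic number of channel uses of the serial
fronthaul and wireless transmission, per bit of a file, for the worst demand. -/
noncomputable def Scheme.dtb {N : ℕ} {μ nF : ℝ} {n : Channel} (c : Scheme N μ nF n) : EReal :=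
  ⨆ d : Demand N,
    limsup (fun L : ℕ => (((((c L).TF d : ℝ) + ((c L).TE d : ℝ)) / (L : ℝ) : ℝ) : EReal)) atTop

/-- The minimum delivery time per bit. -/
noncomputable def minDTB (N : ℕ) (μ nF : ℝ) (n : Channel) : EReal :=
  sInf {Δ : EReal | ∃ c : Scheme N μ nF n, c.Reliable ∧ c.dtb = Δ}

namespace Channel

/-- The wireless bottleneck delivery time per bit. -/
noncomputable def ΔLB' (n : Channel) : ℝ :=
  max (1 / (n.d3 : ℝ))
    (max (1 / max (n.d1 : ℝ) (n.d2 : ℝ)) (2 / max ((n.d1 : ℝ) + (n.d3 : ℝ)) (n.d2 : ℝ)))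

/-- The larger of the wireless bottleneck and `1 / (d3 - d2)`, with a real difference. -/
noncomputable def ΔLB'' (n : Channel) : ℝ :=
  max (1 / ((n.d3 : ℝ) - (n.d2 : ℝ))) n.ΔLB'

/-- The broadcast regime with the cross link the stronger eNB link. -/
def I₀ (n : Channel) : Prop := n.d3 ≤ n.d2 ∧ n.d2 ≤ 2 * n.d3

/-- The complementary part of `d3 ≤ d2`, with its boundary. -/
def I₀c (n : Channel) : Prop := n.d3 ≤ n.d2 ∧ 2 * n.d3 ≤ n.d2

/-- The broadcast regime with the cross link the weaker eNB link. -/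
def I₁ (n : Channel) : Prop := n.d2 ≤ n.d3 ∧ n.d3 ≤ 2 * n.d2

/-- The complementary part of `d2 ≤ d3`, with its boundary. -/
def I₁c (n : Channel) : Prop := n.d2 ≤ n.d3 ∧ 2 * n.d2 ≤ n.d3

/-- Class I of channel regimes. -/
def ClassI (n : Channel) : Prop := (n.I₀ ∧ n.d2 ≤ n.d1 + n.d3) ∨ n.I₁

/-- Class II of channel regimes. -/
def ClassII (n : Channel) : Prop :=
  n.I₁c ∧ n.ΔLB' ≤ 1 / ((n.d3 : ℝ) - (n.d2 : ℝ)) ∧ n.ΔLB' ≤ 1 / (n.d2 : ℝ)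

/-- Class III of channel regimes. -/
def ClassIII (n : Channel) : Prop :=
  n.I₁c ∧ 1 / ((n.d3 : ℝ) - (n.d2 : ℝ)) ≤ n.ΔLB' ∧ n.ΔLB' ≤ 1 / (n.d2 : ℝ)

/-- Class IV of channel regimes. -/
def ClassIV (n : Channel) : Prop :=
  (n.I₀c ∨ n.d1 + n.d3 ≤ n.d2) ∨ (n.I₁c ∧ 1 / (n.d2 : ℝ) ≤ n.ΔLB')

end Channel

end HetNet

/-! The minimum delivery time is the value of a linear program in the fronthaul time τF and the
wireless time τE per bit: minimise τF + τE subject to τF ≥ 0, τE ≥ `ΔLB'`, nF τF + max(d2, d3) τE ≥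
2 - μ and nF τF + d2 τE ≥ 1 - μ.

Necessity (`le_minDTB`) is a counting argument. Once the error probabilities are small, at least
half of all libraries are decoded correctly by both users; on these, any data that determine the
requested files must take almost as many values as the files do. Different choices of data give the
constraints: received levels alone give `ΔLB'`, while cache, fronthaul message and eNB levels
together give the other two.

Sufficiency (`minDTB_le`) uses error-free codes without any coding over blocks. T channel uses act
as one use of a channel with all level counts multiplied by T, so it is enough to place uncoded bits
on levels (`Placement.exists_of_le`). The HeNB sends b bits of user 1, each added to the bit of user
2 occupying the same level, so that the interference cancels. Colliding bits have equal indices in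
their files; hence the cache supplies the first ⌊μL⌋ of these sums, and each further sum costs a
single fronthaul bit (`Code.exists_of_le`).

The closed forms are then the optimal vertices of the program. The class statements record which of
the terms are dominated. -/

namespace HetNet

/-! ### Bit levels of the shift channel. -/

theorem downShift_mulVec (q : ℕ) (x : Fin q → Bit) (i : Fin q) :
    (downShift q).mulVec x i = if 1 ≤ (i : ℕ) then x ⟨i - 1, by omega⟩ else 0 := by
  simp only [Matrix.mulVec, dotProduct, downShift, Matrix.of_apply, ite_mul, one_mul, zero_mul]
  split_ifs with h
  · rw [Finset.sum_eq_single ⟨(i : ℕ) - 1, by omega⟩]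
    · rw [if_pos]
      simp only
      omega
    · intro j _ hj
      rw [if_neg]
      intro hij
      exact hj (Fin.ext (by simp only; omega))
    · simp
  · refine Finset.sum_eq_zero fun j _ => if_neg ?_
    omega

theorem downShift_pow_mulVec (q k : ℕ) (x : Fin q → Bit) (i : Fin q) :
    (downShift q ^ k).mulVec x i = if k ≤ (i : ℕ) then x ⟨i - k, by omega⟩ else 0 := by
  induction k generalizing i with
  | zero => simp
  | succ k ih =>
    rw [pow_succ', ← Matrix.mulVec_mulVec, downShift_mulVec]
    split_ifs with h₁ h₂ h₂
    · rw [ih, if_pos (by simp only; omega)]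
      congr 2
      simp only
      omega
    · rw [ih, if_neg (by simp only; omega)]
    · omega
    · rfl

namespace Channel

variable (n : Channel)

theorem d1_le_q : n.d1 ≤ n.q := le_max_left _ _

theorem d2_le_q : n.d2 ≤ n.q := (le_max_left _ _).trans (le_max_right _ _)

theorem d3_le_q : n.d3 ≤ n.q := (le_max_right _ _).trans (le_max_right _ _)

theorem out₁_apply (x₁ x₂ : Fin n.q → Bit) (i : Fin n.q) :
    n.out₁ x₁ x₂ i = (if n.q - n.d1 ≤ (i : ℕ) then x₁ ⟨i - (n.q - n.d1), by omega⟩ else 0) +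
      (if n.q - n.d2 ≤ (i : ℕ) then x₂ ⟨i - (n.q - n.d2), by omega⟩ else 0) := by
  rw [out₁, Pi.add_apply, downShift_pow_mulVec, downShift_pow_mulVec]

theorem out₂_apply (x₂ : Fin n.q → Bit) (i : Fin n.q) :
    n.out₂ x₂ i = if n.q - n.d3 ≤ (i : ℕ) then x₂ ⟨i - (n.q - n.d3), by omega⟩ else 0 := by
  rw [out₂, downShift_pow_mulVec]

/-- The `k` most significant levels of a channel input. -/
def top {n : Channel} {k : ℕ} (hk : k ≤ n.q) (x : Fin n.q → Bit) : Fin k → Bit :=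
  fun j => x (Fin.castLE hk j)

/-- The `k` least significant levels of a channel output. -/
def bottom {n : Channel} {k : ℕ} (hk : k ≤ n.q) (y : Fin n.q → Bit) : Fin k → Bit :=
  fun j => y (Fin.castLE hk j).rev

variable {n}

theorem eq_of_top_eq {k : ℕ} {hk : k ≤ n.q} {x x' : Fin n.q → Bit} (h : top hk x = top hk x')
    (i : Fin n.q) (hi : (i : ℕ) < k) : x i = x' i :=
  congr_fun h ⟨i, hi⟩

theorem eq_of_bottom_eq {k : ℕ} {hk : k ≤ n.q} {y y' : Fin n.q → Bit}
    (h : bottom hk y = bottom hk y') (i : Fin n.q) (hi : n.q - k ≤ (i : ℕ)) : y i = y' i := by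
  have h' : y i.rev.rev = y' i.rev.rev :=
    congr_fun h ⟨i.rev, by rw [Fin.val_rev]; omega⟩
  rwa [Fin.rev_rev] at h'

theorem out₂_congr {x x' : Fin n.q → Bit} (h : ∀ i : Fin n.q, (i : ℕ) < n.d3 → x i = x' i) :
    n.out₂ x = n.out₂ x' := by
  ext1 i
  have := n.d3_le_q
  rw [out₂_apply, out₂_apply]
  split_ifs
  · exact h _ (by simp only; omega)
  · rfl

theorem out₁_congr (x₁ : Fin n.q → Bit) {x x' : Fin n.q → Bit}
    (h : ∀ i : Fin n.q, (i : ℕ) < n.d2 → x i = x' i) : n.out₁ x₁ x = n.out₁ x₁ x' := by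
  ext1 i
  have := n.d2_le_q
  rw [out₁_apply, out₁_apply]
  congr 1
  split_ifs
  · exact h _ (by simp only; omega)
  · rfl

/-- If the `k` strongest levels of the eNB signal are known, then the output at user 1 is
determined by its `max d1 (d2 - k)` lowest levels. -/
theorem out₁_eq_of_bottom_eq (k : ℕ) {m : ℕ} (hm : max n.d1 (n.d2 - k) = m)
    {x₁ x₁' x x' : Fin n.q → Bit}
    (hk : ∀ i : Fin n.q, (i : ℕ) < k → x i = x' i)
    (h : ∀ i : Fin n.q, n.q - m ≤ (i : ℕ) → n.out₁ x₁ x i = n.out₁ x₁' x' i) :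
    n.out₁ x₁ x = n.out₁ x₁' x' := by
  ext1 i
  have h1 := n.d1_le_q
  have h2 := n.d2_le_q
  by_cases hi : n.q - m ≤ (i : ℕ)
  · exact h i hi
  · have h3 : ¬ n.q - n.d1 ≤ (i : ℕ) := by omega
    simp only [out₁_apply, if_neg h3]
    congr 1
    split_ifs
    · exact hk _ (by simp only; omega)
    · rfl

end Channel

/-! ### Converse: counting bounds for a single code. -/

theorem card_library (N L : ℕ) : Fintype.card (Library N L) = 2 ^ (L * N) := by
  simp [Library, pow_mul]

/-- The size of a set of libraries on which the files in `D` are determined by the value of `f`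
and the other files. -/
theorem card_le_of_determined {N L : ℕ} (G : Finset (Library N L)) (D : Finset (Fin N))
    {β : Type*} [Fintype β] (f : Library N L → β)
    (hf : ∀ W ∈ G, ∀ W' ∈ G, f W = f W' → (∀ j, j ∉ D → W j = W' j) → W = W') :
    G.card ≤ Fintype.card β * 2 ^ (L * (N - D.card)) := by
  classical
  have hcard : Fintype.card (β × ({j : Fin N // j ∉ D} → Fin L → Bit)) =
      Fintype.card β * 2 ^ (L * (N - D.card)) := by
    rw [Fintype.card_prod, Fintype.card_fun, Fintype.card_fun, Fintype.card_subtype_compl]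
    simp [pow_mul]
  rw [← hcard, ← Fintype.card_coe G]
  refine Fintype.card_le_of_injective
    (fun W => (f W.1, fun j => W.1 j.1)) fun W W' h => Subtype.ext ?_
  rw [Prod.mk.injEq] at h
  exact hf _ W.2 _ W'.2 h.1 fun j hj => congr_fun h.2 ⟨j, hj⟩

/-- A counting substitute for Fano's inequality. Restricting to half of the libraries costs only one
bit, which is the `+ 1`. -/
theorem length_mul_card_le {N L B : ℕ} {G : Finset (Library N L)}
    (hG : Fintype.card (Library N L) ≤ 2 * G.card) (D : Finset (Fin N))
    {β : Type*} [Fintype β] (hβ : Fintype.card β = 2 ^ B) (f : Library N L → β)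
    (hf : ∀ W ∈ G, ∀ W' ∈ G, f W = f W' → (∀ j, j ∉ D → W j = W' j) → W = W') :
    L * D.card ≤ B + 1 := by
  have h := card_le_of_determined G D f hf
  have hD : D.card ≤ N := by simpa using D.card_le_univ
  have h2 : 2 ^ (L * N) ≤ 2 ^ (1 + (B + L * (N - D.card))) := by
    rw [pow_add, pow_add, pow_one, ← hβ, ← card_library]
    omega
  have h3 := (Nat.pow_le_pow_iff_right one_lt_two).1 h2
  have h4 : L * N = L * D.card + L * (N - D.card) := by
    rw [← mul_add, Nat.add_sub_cancel' hD]
  omega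

namespace Code

variable {N : ℕ} {μ nF : ℝ} {n : Channel} {L : ℕ}

/-- The libraries for which both users decode correctly. -/
def good (c : Code N μ nF n L) (d : Demand N) : Finset (Library N L) :=
  Finset.univ.filter fun W => ∀ k, c.decode k d (c.received k d W) = W (d k)

theorem card_library_le_two_mul_good (c : Code N μ nF n L) (d : Demand N)
    (h : ∀ k, c.errorProb k d ≤ 1 / 4) :
    Fintype.card (Library N L) ≤ 2 * (c.good d).card := by
  classical
  let bad (k : Fin 2) : Finset (Library N L) :=
    Finset.univ.filter fun W => c.decode k d (c.received k d W) ≠ W (d k)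
  have hcover : (Finset.univ : Finset (Library N L)) ⊆ c.good d ∪ (bad 0 ∪ bad 1) := by
    intro W _
    simp only [good, bad, Finset.mem_union, Finset.mem_filter, Finset.mem_univ, true_and,
      Fin.forall_fin_two]
    tauto
  have hcard := (Finset.card_le_card hcover).trans ((Finset.card_union_le _ _).trans
    (Nat.add_le_add_left (Finset.card_union_le _ _) _))
  rw [Finset.card_univ] at hcard
  have hbad (k : Fin 2) : ((bad k).card : ℝ) ≤ 1 / 4 * (Fintype.card (Library N L) : ℝ) :=
    (div_le_iff₀ (by exact_mod_cast Fintype.card_pos)).1 (h k)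
  have h0 := hbad 0
  have h1 := hbad 1
  have hcard' : (Fintype.card (Library N L) : ℝ) ≤
      (c.good d).card + ((bad 0).card + (bad 1).card) := by exact_mod_cast hcard
  have : (Fintype.card (Library N L) : ℝ) ≤ 2 * ((c.good d).card : ℝ) := by linarith
  exact_mod_cast this

theorem file_eq (c : Code N μ nF n L) {d : Demand N} {W W' : Library N L} (hW : W ∈ c.good d)
    (hW' : W' ∈ c.good d) (k : Fin 2) (h : c.received k d W = c.received k d W') :
    W (d k) = W' (d k) := by
  simp only [good, Finset.mem_filter, Finset.mem_univ, true_and] at hW hW'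
  rw [← hW k, ← hW' k, h]

theorem received_zero_eq (c : Code N μ nF n L) {d : Demand N} {W W' : Library N L}
    (h : ∀ t, n.out₁ (c.x₁ d W t) (c.eNB d W t) = n.out₁ (c.x₁ d W' t) (c.eNB d W' t)) :
    c.received 0 d W = c.received 0 d W' := by
  ext1 t
  simpa [received] using h t

theorem received_one_eq (c : Code N μ nF n L) {d : Demand N} {W W' : Library N L}
    (h : ∀ t, ∀ i : Fin n.q, (i : ℕ) < n.d3 → c.eNB d W t i = c.eNB d W' t i) :
    c.received 1 d W = c.received 1 d W' := by
  ext1 t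
  simpa [received] using Channel.out₂_congr (h t)

theorem length_le_d3 (c : Code N μ nF n L) (d : Demand N) (h : ∀ k, c.errorProb k d ≤ 1 / 4) :
    L ≤ n.d3 * c.TE d + 1 := by
  have key := length_mul_card_le (c.card_library_le_two_mul_good d h) {d 1}
    (B := n.d3 * c.TE d) (β := Fin (c.TE d) → Fin n.d3 → Bit) (by simp [pow_mul])
    (fun W t => Channel.top n.d3_le_q (c.eNB d W t)) (by
      intro W hW W' hW' hf ho
      have h1 := c.file_eq hW hW' 1
        (c.received_one_eq fun t => Channel.eq_of_top_eq (congr_fun hf t))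
      ext1 j
      by_cases hj : j = d 1
      · rw [hj, h1]
      · exact ho j (by simpa using hj))
  simpa using key

theorem length_le_max (c : Code N μ nF n L) (d : Demand N) (h : ∀ k, c.errorProb k d ≤ 1 / 4) :
    L ≤ max n.d1 n.d2 * c.TE d + 1 := by
  have key := length_mul_card_le (c.card_library_le_two_mul_good d h) {d 0}
    (B := max n.d1 n.d2 * c.TE d) (β := Fin (c.TE d) → Fin (max n.d1 n.d2) → Bit)
    (by simp [pow_mul])
    (fun W t => Channel.bottom (max_le n.d1_le_q n.d2_le_q) (c.received 0 d W t)) (by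
      intro W hW W' hW' hf ho
      have h1 := c.file_eq hW hW' 0 (c.received_zero_eq fun t =>
        Channel.out₁_eq_of_bottom_eq 0 rfl (fun i hi => absurd hi (Nat.not_lt_zero _)) (by
          simpa [received] using Channel.eq_of_bottom_eq (congr_fun hf t)))
      ext1 j
      by_cases hj : j = d 0
      · rw [hj, h1]
      · exact ho j (by simpa using hj))
  simpa using key

theorem eq_of_agree {W W' : Library N L} {d : Demand N} (h0 : W (d 0) = W' (d 0))
    (h1 : W (d 1) = W' (d 1)) (ho : ∀ j, j ∉ ({d 0, d 1} : Finset (Fin N)) → W j = W' j) :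
    W = W' := by
  ext1 j
  by_cases hj : j ∈ ({d 0, d 1} : Finset (Fin N))
  · rcases Finset.mem_insert.1 hj with rfl | hj
    · exact h0
    · rw [Finset.mem_singleton.1 hj, h1]
  · exact ho j hj

/-- The top `d3` eNB levels reveal the file of user 2. With these known, only the lowest `max d1 (d2
- d3)` levels at user 1 carry anything new; the two counts add up to `max (d1 + d3) d2`. -/
theorem two_mul_length_le_max (c : Code N μ nF n L) (d : Demand N) (hd : d 0 ≠ d 1)
    (h : ∀ k, c.errorProb k d ≤ 1 / 4) :
    2 * L ≤ max (n.d1 + n.d3) n.d2 * c.TE d + 1 := by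
  have hm : max n.d1 (n.d2 - n.d3) ≤ n.q :=
    max_le n.d1_le_q ((Nat.sub_le _ _).trans n.d2_le_q)
  have key := length_mul_card_le (c.card_library_le_two_mul_good d h) {d 0, d 1}
    (B := n.d3 * c.TE d + max n.d1 (n.d2 - n.d3) * c.TE d)
    (β := (Fin (c.TE d) → Fin n.d3 → Bit) × (Fin (c.TE d) → Fin (max n.d1 (n.d2 - n.d3)) → Bit))
    (by simp [pow_mul, pow_add])
    (fun W => (fun t => Channel.top n.d3_le_q (c.eNB d W t),
      fun t => Channel.bottom hm (c.received 0 d W t))) (by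
      intro W hW W' hW' hf ho
      rw [Prod.mk.injEq] at hf
      have ht t := Channel.eq_of_top_eq (congr_fun hf.1 t)
      have h1 := c.file_eq hW hW' 1 (c.received_one_eq ht)
      have h0 := c.file_eq hW hW' 0 (c.received_zero_eq fun t =>
        Channel.out₁_eq_of_bottom_eq n.d3 rfl (ht t) (by
          simpa [received] using Channel.eq_of_bottom_eq (congr_fun hf.2 t)))
      exact eq_of_agree h0 h1 ho)
  rw [Finset.card_pair hd, ← add_mul] at key
  have h2 : n.d3 + max n.d1 (n.d2 - n.d3) = max (n.d1 + n.d3) n.d2 := by omega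
  rw [h2] at key
  omega

theorem x₁_eq (c : Code N μ nF n L) {d : Demand N} {W W' : Library N L}
    (hS : ∀ i, c.cache i (W i) = c.cache i (W' i)) (hF : c.fronthaul d W = c.fronthaul d W') :
    c.x₁ d W = c.x₁ d W' := by
  rw [x₁, x₁, hF, funext hS]

/-- Only one cached file is charged: the eNB levels already determine the file of user 2, hence also
its cached part, and then the HeNB signal. This is why the bound has 2 - μ and not 2 - 2μ. -/
theorem two_mul_length_le_cache (c : Code N μ nF n L) (d : Demand N) (hd : d 0 ≠ d 1)
    (h : ∀ k, c.errorProb k d ≤ 1 / 4) :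
    2 * L ≤ ⌊μ * L⌋₊ + ⌊nF * c.TF d⌋₊ + max n.d2 n.d3 * c.TE d + 1 := by
  have hm : max n.d2 n.d3 ≤ n.q := max_le n.d2_le_q n.d3_le_q
  have key := length_mul_card_le (c.card_library_le_two_mul_good d h) {d 0, d 1}
    (B := ⌊μ * L⌋₊ + ⌊nF * c.TF d⌋₊ + max n.d2 n.d3 * c.TE d)
    (β := ((Fin ⌊μ * L⌋₊ → Bit) × (Fin ⌊nF * c.TF d⌋₊ → Bit)) ×
      (Fin (c.TE d) → Fin (max n.d2 n.d3) → Bit))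
    (by simp [pow_mul, pow_add])
    (fun W => ((c.cache (d 0) (W (d 0)), c.fronthaul d W),
      fun t => Channel.top hm (c.eNB d W t))) (by
      intro W hW W' hW' hf ho
      rw [Prod.mk.injEq, Prod.mk.injEq] at hf
      have ht t := Channel.eq_of_top_eq (congr_fun hf.2 t)
      have h1 := c.file_eq hW hW' 1 (c.received_one_eq fun t i hi => ht t i (by omega))
      have hx : c.x₁ d W = c.x₁ d W' := by
        refine c.x₁_eq (fun i => ?_) hf.1.2
        by_cases hi0 : i = d 0
        · rw [hi0, hf.1.1]
        by_cases hi1 : i = d 1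
        · rw [hi1, h1]
        rw [ho i (by simp [hi0, hi1])]
      have h0 := c.file_eq hW hW' 0 (c.received_zero_eq fun t => by
        rw [hx]
        exact Channel.out₁_congr _ fun i hi => ht t i (by omega))
      exact eq_of_agree h0 h1 ho)
  rw [Finset.card_pair hd] at key
  omega

/-- All files except that of user 1 count as known, so its cached part and the fronthaul message fix
the HeNB signal, and user 1 sees only `d2` levels of the eNB. -/
theorem length_le_cache (c : Code N μ nF n L) (d : Demand N)
    (h : ∀ k, c.errorProb k d ≤ 1 / 4) :
    L ≤ ⌊μ * L⌋₊ + ⌊nF * c.TF d⌋₊ + n.d2 * c.TE d + 1 := by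
  have key := length_mul_card_le (c.card_library_le_two_mul_good d h) {d 0}
    (B := ⌊μ * L⌋₊ + ⌊nF * c.TF d⌋₊ + n.d2 * c.TE d)
    (β := ((Fin ⌊μ * L⌋₊ → Bit) × (Fin ⌊nF * c.TF d⌋₊ → Bit)) ×
      (Fin (c.TE d) → Fin n.d2 → Bit))
    (by simp [pow_mul, pow_add])
    (fun W => ((c.cache (d 0) (W (d 0)), c.fronthaul d W),
      fun t => Channel.top n.d2_le_q (c.eNB d W t))) (by
      intro W hW W' hW' hf ho
      rw [Prod.mk.injEq, Prod.mk.injEq] at hf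
      have ht t := Channel.eq_of_top_eq (congr_fun hf.2 t)
      have hx : c.x₁ d W = c.x₁ d W' := by
        refine c.x₁_eq (fun i => ?_) hf.1.2
        by_cases hi0 : i = d 0
        · rw [hi0, hf.1.1]
        · rw [ho i (by simpa using hi0)]
      have h0 := c.file_eq hW hW' 0 (c.received_zero_eq fun t => by
        rw [hx]
        exact Channel.out₁_congr _ (ht t))
      ext1 j
      by_cases hj : j = d 0
      · rw [hj, h0]
      · exact ho j (by simpa using hj))
  simpa using key

end Code

/-! ### Achievability: placing bits on levels. -/

/-- A placement of two files of `L` bits on the levels of a channel with `D₁`, `D₂`, `D₃` levels.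
Levels are indexed downwards relative to the eNB signal, so that user 2 observes the levels in
`[0, D₃)` of the eNB, and user 1 those in `[0, D₂)` of the eNB and in `[D₂ - D₁, D₂)` of the HeNB.
The first `b` bits of the file of user 1 are sent by the HeNB. -/
structure Placement (D₁ D₂ D₃ L b : ℕ) where
  /-- The levels of the bits of user 1. -/
  pos₁ : Fin L → ℤ
  /-- The levels of the bits of user 2. -/
  pos₂ : Fin L → ℤ
  pos₁_injective : Function.Injective pos₁
  pos₂_injective : Function.Injective pos₂
  pos₁_lt : ∀ i, pos₁ i < D₂
  le_pos₁ : ∀ i : Fin L, (i : ℕ) < b → (D₂ : ℤ) - D₁ ≤ pos₁ i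
  pos₁_nonneg : ∀ i : Fin L, b ≤ (i : ℕ) → 0 ≤ pos₁ i
  pos₂_nonneg : ∀ j, 0 ≤ pos₂ j
  pos₂_lt : ∀ j, pos₂ j < D₃
  -- Only HeNB bits may collide, and only with the bit of the same index: the HeNB can then cancel
  -- the interference from equally indexed cache entries.
  lt_of_collision : ∀ i j, pos₁ i = pos₂ j → (i : ℕ) < b
  eq_of_collision : ∀ i j, pos₁ i = pos₂ j → i = j

/-- User 2 fills `[D₃ - L, D₃)`. The eNB serves user 1 on the levels outside this block that user 1
sees, and `b` is the number of bits that do not fit there. The HeNB sends those, first on top of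
bits of user 2 and then on negative levels, where the eNB is silent. -/
theorem Placement.exists_of_le {D₁ D₂ D₃ L : ℕ} (h₃ : L ≤ D₃) (h₁ : L ≤ max D₁ D₂)
    (h₂ : 2 * L ≤ max (D₁ + D₃) D₂) :
    Nonempty (Placement D₁ D₂ D₃ L (max (2 * L - max D₂ D₃) (L - D₂))) := by
  obtain ⟨b, hb⟩ : ∃ b, b = max (2 * L - max D₂ D₃) (L - D₂) := ⟨_, rfl⟩
  -- Levels below `e` are seen by both users, `s` levels are free above the block of user 2, and `r`
  -- of its levels are common. The HeNB reaches the weakest levels first, so common levels are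
  -- filled upwards from `e - 1`; `a` of them can be shared with the HeNB. The eNB gives `f` of the
  -- free levels to user 1.
  obtain ⟨e, he⟩ : ∃ e, e = min D₂ D₃ := ⟨_, rfl⟩
  obtain ⟨s, hs⟩ : ∃ s, s = D₃ - L := ⟨_, rfl⟩
  obtain ⟨r, hr⟩ : ∃ r, r = e - s := ⟨_, rfl⟩
  obtain ⟨a, ha⟩ : ∃ a, a = min r (e - (D₂ - D₁)) := ⟨_, rfl⟩
  obtain ⟨f, hf⟩ : ∃ f, f = min s D₂ := ⟨_, rfl⟩
  rw [← hb]
  exact ⟨{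
    pos₁ := fun i => if (i : ℕ) < b then (if (i : ℕ) < a then (e : ℤ) - 1 - i else (a : ℤ) - 1 - i)
      else if (i : ℕ) < b + f then (i : ℤ) - b else (D₃ : ℤ) + (i - b - f)
    pos₂ := fun j => if (j : ℕ) < r then (e : ℤ) - 1 - j else (s : ℤ) + j
    pos₁_injective := by
      intro i j hij
      dsimp only at hij
      apply Fin.ext
      split_ifs at hij <;> omega
    pos₂_injective := by
      intro i j hij
      dsimp only at hij
      apply Fin.ext
      split_ifs at hij <;> omega
    pos₁_lt := by
      intro i
      split_ifs <;> omega
    le_pos₁ := by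
      intro i hi
      split_ifs <;> omega
    pos₁_nonneg := by
      intro i hi
      split_ifs <;> omega
    pos₂_nonneg := by
      intro i
      split_ifs <;> omega
    pos₂_lt := by
      intro i
      split_ifs <;> omega
    lt_of_collision := by
      intro i j hij
      split_ifs at hij <;> omega
    eq_of_collision := by
      intro i j hij
      apply Fin.ext
      split_ifs at hij <;> omega }⟩

namespace Placement

variable {D₁ D₂ D₃ L b : ℕ} (P : Placement D₁ D₂ D₃ L b)

/-- The levels of the eNB signal. -/
def eNBSignal (w₁ w₂ : Fin L → Bit) (p : ℤ) : Bit :=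
  (∑ j, if P.pos₂ j = p then w₂ j else 0) +
    ∑ i : Fin L, if b ≤ (i : ℕ) ∧ P.pos₁ i = p then w₁ i else 0

/-- The levels of the HeNB signal, which carries the bits `z`. -/
def heNBSignal (z : Fin L → Bit) (p : ℤ) : Bit :=
  ∑ i : Fin L, if (i : ℕ) < b ∧ P.pos₁ i = p then z i else 0

/-- A bit of user 1, plus the bit of user 2 with which it collides. -/
def sideInfo (w₁ w₂ : Fin L → Bit) (i : Fin L) : Bit :=
  w₁ i + if P.pos₁ i = P.pos₂ i then w₂ i else 0

theorem eNBSignal_of_neg (w₁ w₂ : Fin L → Bit) {p : ℤ} (hp : p < 0) : P.eNBSignal w₁ w₂ p = 0 := by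
  rw [eNBSignal, Finset.sum_eq_zero, Finset.sum_eq_zero, add_zero]
  · rintro i -
    refine if_neg fun h => ?_
    have := P.pos₁_nonneg i h.1
    omega
  · rintro i -
    refine if_neg fun h => ?_
    have := P.pos₂_nonneg i
    omega

theorem heNBSignal_of_lt (z : Fin L → Bit) {p : ℤ} (hp : p < (D₂ : ℤ) - D₁) :
    P.heNBSignal z p = 0 := by
  rw [heNBSignal, Finset.sum_eq_zero]
  rintro i -
  refine if_neg fun h => ?_
  have := P.le_pos₁ i h.1
  omega

theorem heNBSignal_congr {z z' : Fin L → Bit} (h : ∀ i : Fin L, (i : ℕ) < b → z i = z' i) :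
    P.heNBSignal z = P.heNBSignal z' := by
  ext1 p
  refine Finset.sum_congr rfl fun i _ => ?_
  split_ifs with hi
  · exact h i hi.1
  · rfl

theorem eNBSignal_pos₂ (w₁ w₂ : Fin L → Bit) (j : Fin L) :
    P.eNBSignal w₁ w₂ (P.pos₂ j) = w₂ j := by
  rw [eNBSignal, Finset.sum_eq_single j, Finset.sum_eq_zero, if_pos rfl, add_zero]
  · rintro i -
    refine if_neg fun h => ?_
    have := P.lt_of_collision i j h.2
    omega
  · intro i _ hi
    exact if_neg fun h => hi (P.pos₂_injective h)
  · simp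

theorem heNBSignal_add_eNBSignal (w₁ w₂ : Fin L → Bit) (i : Fin L) :
    P.heNBSignal (P.sideInfo w₁ w₂) (P.pos₁ i) + P.eNBSignal w₁ w₂ (P.pos₁ i) = w₁ i := by
  have h1 : P.heNBSignal (P.sideInfo w₁ w₂) (P.pos₁ i) =
      if (i : ℕ) < b then P.sideInfo w₁ w₂ i else 0 := by
    rw [heNBSignal, Finset.sum_eq_single i]
    · simp
    · intro k _ hk
      exact if_neg fun h => hk (P.pos₁_injective h.2)
    · simp
  have h2 : (∑ k : Fin L, if b ≤ (k : ℕ) ∧ P.pos₁ k = P.pos₁ i then w₁ k else 0) =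
      if b ≤ (i : ℕ) then w₁ i else 0 := by
    rw [Finset.sum_eq_single i]
    · simp
    · intro k _ hk
      exact if_neg fun h => hk (P.pos₁_injective h.2)
    · simp
  have h3 : (∑ j, if P.pos₂ j = P.pos₁ i then w₂ j else 0) =
      if P.pos₁ i = P.pos₂ i then w₂ i else 0 := by
    rw [Finset.sum_eq_single i]
    · simp only [eq_comm]
    · intro k _ hk
      exact if_neg fun h => hk (P.eq_of_collision i k h.symm).symm
    · simp
  rw [eNBSignal, h1, h2, h3, sideInfo]
  by_cases hi : (i : ℕ) < b
  · rw [if_pos hi, if_neg (not_le.2 hi), add_zero, add_assoc, CharTwo.add_self_eq_zero, add_zero]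
  · have hne : P.pos₁ i ≠ P.pos₂ i := fun h => hi (P.lt_of_collision i i h)
    rw [if_neg hi, if_pos (not_lt.1 hi), if_neg hne, zero_add, zero_add]

end Placement

/-! ### Channel uses as additional levels. -/

namespace Channel

/-- Over `T` uses, every level at user 1 of the channel with levels scaled by `T` is observed. -/
theorem exists_out₁_eq (n : Channel) {T : ℕ} {p : ℤ} (hp : p < (n.d2 * T : ℕ))
    (hp' : 0 ≤ p ∨ ((n.d2 * T : ℕ) : ℤ) - (n.d1 * T : ℕ) ≤ p) :
    ∃ (t : Fin T) (i : Fin n.q), ∀ X₁ X₂ : ℤ → Bit,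
      (∀ p' : ℤ, p' < ((n.d2 * T : ℕ) : ℤ) - (n.d1 * T : ℕ) → X₁ p' = 0) →
      (∀ p' < 0, X₂ p' = 0) →
      n.out₁ (fun k => X₁ (((k : ℕ) + n.d2 - n.d1 : ℤ) * T + (t : ℕ)))
        (fun k => X₂ (((k : ℕ) : ℤ) * T + (t : ℕ))) i = X₁ p + X₂ p := by
  have hT : 0 < T := by
    rcases Nat.eq_zero_or_pos T with rfl | h
    · simp at hp hp'
      omega
    · exact h
  have hT' : (0 : ℤ) < T := by exact_mod_cast hT
  have h1 := n.d1_le_q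
  have h2 := n.d2_le_q
  push_cast at hp hp' ⊢
  have ht0 := Int.emod_nonneg p hT'.ne'
  have ht1 := Int.emod_lt_of_pos p hT'
  have hdiv := Int.mul_ediv_add_emod p T
  have hl1 : p / T < n.d2 := Int.ediv_lt_of_lt_mul hT' hp
  have hl0 : -(p / T) ≤ n.q - n.d2 := by
    rcases hp' with h | h
    · have := Int.ediv_nonneg h hT'.le
      omega
    · have : (n.d2 : ℤ) - n.d1 ≤ p / T := Int.le_ediv_of_mul_le hT' (by linarith)
      omega
  -- Level `p` of the scaled channel is level `p / T` in use `p % T`. Floor division also handles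
  -- negative `p`, where only the HeNB is heard.
  refine ⟨⟨(p % T).toNat, by omega⟩, ⟨(p / T + n.q - n.d2).toNat, by omega⟩, ?_⟩
  intro X₁ X₂ hX₁ hX₂
  rw [out₁_apply]
  congr 1
  · split_ifs with h
    · congr 1
      simp only at h ⊢
      have e : (((p / T + n.q - n.d2).toNat - (n.q - n.d1) : ℕ) : ℤ) + n.d2 - n.d1 = p / T := by
        omega
      rw [e, Int.toNat_of_nonneg ht0]
      linarith
    · simp only at h
      refine (hX₁ p ?_).symm
      have : p / T + 1 ≤ (n.d2 : ℤ) - n.d1 := by omega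
      nlinarith
  · split_ifs with h
    · congr 1
      simp only at h ⊢
      have e : (((p / T + n.q - n.d2).toNat - (n.q - n.d2) : ℕ) : ℤ) = p / T := by
        omega
      rw [e, Int.toNat_of_nonneg ht0]
      linarith
    · simp only at h
      refine (hX₂ p ?_).symm
      have : p / T + 1 ≤ 0 := by omega
      nlinarith

/-- Over `T` uses, every level at user 2 of the channel with levels scaled by `T` is observed. -/
theorem exists_out₂_eq (n : Channel) {T : ℕ} {p : ℤ} (hp : p < (n.d3 * T : ℕ)) (hp' : 0 ≤ p) :
    ∃ (t : Fin T) (i : Fin n.q), ∀ X₂ : ℤ → Bit,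
      n.out₂ (fun k => X₂ (((k : ℕ) : ℤ) * T + (t : ℕ))) i = X₂ p := by
  have hT : 0 < T := by
    rcases Nat.eq_zero_or_pos T with rfl | h
    · simp at hp
      omega
    · exact h
  have hT' : (0 : ℤ) < T := by exact_mod_cast hT
  have h3 := n.d3_le_q
  push_cast at hp
  have ht0 := Int.emod_nonneg p hT'.ne'
  have ht1 := Int.emod_lt_of_pos p hT'
  have hdiv := Int.mul_ediv_add_emod p T
  have hl1 : p / T < n.d3 := Int.ediv_lt_of_lt_mul hT' hp
  have hl0 := Int.ediv_nonneg hp' hT'.le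
  refine ⟨⟨(p % T).toNat, by omega⟩, ⟨(p / T + n.q - n.d3).toNat, by omega⟩, fun X₂ => ?_⟩
  rw [out₂_apply, if_pos (by simp only; omega)]
  congr 1
  simp only
  have e : (((p / T + n.q - n.d3).toNat - (n.q - n.d3) : ℕ) : ℤ) = p / T := by omega
  rw [e, Int.toNat_of_nonneg ht0]
  linarith

end Channel

/-! ### Codes built from placements. -/

/-- Encoders from which the requested files can be recovered extend to a code without errors. -/
theorem Code.exists_errorProb_eq_zero {N : ℕ} {μ nF : ℝ} {n : Channel} {L : ℕ}
    (c : Code N μ nF n L)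
    (h : ∀ k d W W', c.received k d W = c.received k d W' → W (d k) = W' (d k)) :
    ∃ c' : Code N μ nF n L, c'.TF = c.TF ∧ c'.TE = c.TE ∧ ∀ k d, c'.errorProb k d = 0 := by
  classical
  refine ⟨{ c with decode := fun k d =>
    Function.extend (c.received k d) (fun W => W (d k)) fun _ => 0 }, rfl, rfl, fun k d => ?_⟩
  have hz : (Function.extend (c.received k d) (fun W : Library N L => W (d k)) fun _ => 0) ∘
      c.received k d = fun W => W (d k) := by
    ext1 W
    exact Function.FactorsThrough.extend_apply (fun W W' hW => h k d W W' hW) _ W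
  rw [errorProb, Finset.filter_false_of_mem, Finset.card_empty, Nat.cast_zero, zero_div]
  intro W _
  exact not_not_intro (congr_fun hz W)

/-- The code of a placement: the HeNB caches the first bits of every file and receives the
following side information over the fronthaul. -/
noncomputable def Placement.code {n : Channel} {TE L b : ℕ}
    (P : Placement (n.d1 * TE) (n.d2 * TE) (n.d3 * TE) L b) (N : ℕ) {μ : ℝ} (nF : ℝ) (TF : ℕ)
    (hcache : ⌊μ * L⌋₊ ≤ L) : Code N μ nF n L where
  cache _ w j := w (Fin.castLE hcache j)
  TF _ := TF
  TE _ := TE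
  fronthaul d W j :=
    if h : ⌊μ * L⌋₊ + j < L then P.sideInfo (W (d 0)) (W (d 1)) ⟨_, h⟩ else 0
  heNB d S F t k := P.heNBSignal
    (fun i => if h : (i : ℕ) < ⌊μ * L⌋₊ then
        S (d 0) ⟨i, h⟩ + (if P.pos₁ i = P.pos₂ i then S (d 1) ⟨i, h⟩ else 0)
      else if h : (i : ℕ) - ⌊μ * L⌋₊ < ⌊nF * TF⌋₊ then F ⟨_, h⟩ else 0)
    (((k : ℕ) + n.d2 - n.d1 : ℤ) * TE + (t : ℕ))
  eNB d W t k := P.eNBSignal (W (d 0)) (W (d 1)) (((k : ℕ) : ℤ) * TE + (t : ℕ))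
  decode _ _ _ _ := 0

namespace Placement

variable {n : Channel} {TE L b : ℕ} (P : Placement (n.d1 * TE) (n.d2 * TE) (n.d3 * TE) L b)
  {N : ℕ} {μ nF : ℝ} {TF : ℕ} (hcache : ⌊μ * L⌋₊ ≤ L)

theorem code_x₁ (hb : b ≤ ⌊μ * L⌋₊ + ⌊nF * TF⌋₊) (d : Demand N) (W : Library N L) (t : Fin TE) :
    (P.code N nF TF hcache).x₁ d W t = fun k : Fin n.q =>
      P.heNBSignal (P.sideInfo (W (d 0)) (W (d 1)))
        (((k : ℕ) + n.d2 - n.d1 : ℤ) * TE + (t : ℕ)) := by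
  ext1 k
  refine congr_fun (P.heNBSignal_congr fun i hi => ?_) _
  by_cases h : (i : ℕ) < ⌊μ * L⌋₊
  · rw [dif_pos h]
    rfl
  · have h' : (i : ℕ) - ⌊μ * L⌋₊ < ⌊nF * TF⌋₊ := by omega
    rw [dif_neg h, dif_pos h']
    have e : ⌊μ * L⌋₊ + ((i : ℕ) - ⌊μ * L⌋₊) = i := by omega
    change (if h : ⌊μ * L⌋₊ + ((i : ℕ) - ⌊μ * L⌋₊) < L then
      P.sideInfo (W (d 0)) (W (d 1)) ⟨_, h⟩ else 0) = _
    simp only [e, dif_pos i.2]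

theorem exists_received_zero (hb : b ≤ ⌊μ * L⌋₊ + ⌊nF * TF⌋₊) (d : Demand N) (i : Fin L) :
    ∃ (t : Fin TE) (l : Fin n.q), ∀ W : Library N L,
      (P.code N nF TF hcache).received 0 d W t l = W (d 0) i := by
  obtain ⟨t, l, hl⟩ := n.exists_out₁_eq (P.pos₁_lt i) (by
    by_cases hi : (i : ℕ) < b
    · exact Or.inr (P.le_pos₁ i hi)
    · exact Or.inl (P.pos₁_nonneg i (not_lt.1 hi)))
  refine ⟨t, l, fun W => ?_⟩
  have h := hl (P.heNBSignal (P.sideInfo (W (d 0)) (W (d 1)))) (P.eNBSignal (W (d 0)) (W (d 1)))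
    (fun p hp => P.heNBSignal_of_lt _ hp) (fun p hp => P.eNBSignal_of_neg _ _ hp)
  rw [P.heNBSignal_add_eNBSignal, ← P.code_x₁ hcache hb d W t] at h
  exact h

theorem exists_received_one (d : Demand N) (j : Fin L) :
    ∃ (t : Fin TE) (l : Fin n.q), ∀ W : Library N L,
      (P.code N nF TF hcache).received 1 d W t l = W (d 1) j := by
  obtain ⟨t, l, hl⟩ := n.exists_out₂_eq (P.pos₂_lt j) (P.pos₂_nonneg j)
  refine ⟨t, l, fun W => ?_⟩
  have h := hl (P.eNBSignal (W (d 0)) (W (d 1)))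
  rw [P.eNBSignal_pos₂] at h
  exact h

end Placement

theorem Code.exists_of_le {N : ℕ} {μ nF : ℝ} {n : Channel} {L : ℕ} (hμ : μ ≤ 1) (TF TE : ℕ)
    (h₃ : L ≤ n.d3 * TE) (h₁ : L ≤ max n.d1 n.d2 * TE) (h₂ : 2 * L ≤ max (n.d1 + n.d3) n.d2 * TE)
    (hc₂ : 2 * L ≤ ⌊μ * L⌋₊ + ⌊nF * TF⌋₊ + max n.d2 n.d3 * TE)
    (hc₁ : L ≤ ⌊μ * L⌋₊ + ⌊nF * TF⌋₊ + n.d2 * TE) :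
    ∃ c : Code N μ nF n L, (∀ d, c.TF d = TF) ∧ (∀ d, c.TE d = TE) ∧
      ∀ k d, c.errorProb k d = 0 := by
  have hcache : ⌊μ * L⌋₊ ≤ L := by
    refine Nat.floor_le_of_le ?_
    have : (0 : ℝ) ≤ L := L.cast_nonneg
    nlinarith
  rw [max_mul_of_nonneg _ _ (Nat.zero_le _)] at h₁ h₂ hc₂
  rw [add_mul] at h₂
  obtain ⟨P⟩ := Placement.exists_of_le h₃ h₁ h₂
  have hb : max (2 * L - max (n.d2 * TE) (n.d3 * TE)) (L - n.d2 * TE) ≤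
      ⌊μ * L⌋₊ + ⌊nF * TF⌋₊ := by omega
  obtain ⟨c, hTF, hTE, hc⟩ := (P.code N nF TF hcache).exists_errorProb_eq_zero (by
    refine Fin.forall_fin_two.2 ⟨fun d W W' h => ?_, fun d W W' h => ?_⟩
    · ext1 i
      obtain ⟨t, l, hl⟩ := P.exists_received_zero hcache hb d i
      rw [← hl W, ← hl W', h]
    · ext1 i
      obtain ⟨t, l, hl⟩ := P.exists_received_one hcache d i
      rw [← hl W, ← hl W', h])
  exact ⟨c, fun d => congr_fun hTF d, fun d => congr_fun hTE d, hc⟩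

/-! ### Reduction to a linear program. -/

variable {N : ℕ} {μ nF : ℝ} {n : Channel}

namespace Channel

theorem ΔLB'_pos (n : Channel) (hd3 : 0 < n.d3) : 0 < n.ΔLB' :=
  lt_max_of_lt_left (one_div_pos.2 (Nat.cast_pos.2 hd3))

/-- The delivery times at least `ΔLB'` are those that meet the wireless rate constraints. -/
theorem ΔLB'_mul_le_iff (n : Channel) (hd2 : 0 < n.d2) (hd3 : 0 < n.d3) {L : ℝ} (hL : 0 ≤ L)
    (t : ℝ) :
    n.ΔLB' * L ≤ t ↔ L ≤ n.d3 * t ∧ L ≤ max (n.d1 : ℝ) n.d2 * t ∧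
      2 * L ≤ max ((n.d1 : ℝ) + n.d3) n.d2 * t := by
  have h2 : (0 : ℝ) < n.d2 := Nat.cast_pos.2 hd2
  have h3 : (0 : ℝ) < n.d3 := Nat.cast_pos.2 hd3
  have aux {a m : ℝ} (hm : 0 < m) : a / m * L ≤ t ↔ a * L ≤ m * t := by
    rw [div_mul_eq_mul_div, div_le_iff₀ hm, mul_comm t]
  rw [ΔLB', max_mul_of_nonneg _ _ hL, max_mul_of_nonneg _ _ hL, max_le_iff, max_le_iff, aux h3,
    aux (lt_max_of_lt_right h2), aux (lt_max_of_lt_right h2), one_mul]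

end Channel

theorem tendsto_add_div_coe (v C : ℝ) :
    Tendsto (fun L : ℕ => ((v + C / (L : ℝ) : ℝ) : EReal)) atTop (𝓝 (v : EReal)) := by
  refine (continuous_coe_real_ereal.tendsto v).comp ?_
  simpa using tendsto_const_nhds.add (tendsto_const_div_atTop_nhds_zero_nat C)

/-- A linear bound on the numbers of channel uses that follows from the rate constraints bounds
the delivery time per bit from below. -/
theorem le_minDTB (hN : 2 ≤ N) (hd2 : 0 < n.d2) (hd3 : 0 < n.d3) (hμ0 : 0 ≤ μ) (hnF : 0 ≤ nF)
    (v C : ℝ)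
    (h : ∀ L tF tE : ℝ, 0 ≤ L → 0 ≤ tF → 0 ≤ tE → n.ΔLB' * L ≤ tE + 1 →
      (2 - μ) * L ≤ nF * tF + max (n.d2 : ℝ) n.d3 * tE + 1 →
      (1 - μ) * L ≤ nF * tF + n.d2 * tE + 1 → v * L ≤ tF + tE + C) :
    (v : EReal) ≤ minDTB N μ nF n := by
  refine le_sInf ?_
  rintro _ ⟨c, hc, rfl⟩
  let d : Demand N := ![⟨0, by omega⟩, ⟨1, by omega⟩]
  have hd : d 0 ≠ d 1 := by simp [d]
  refine le_trans ?_ (le_iSup _ d)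
  rw [← (tendsto_add_div_coe v (-C)).limsup_eq]
  refine limsup_le_limsup ?_
  have hsmall (k : Fin 2) : ∀ᶠ L in atTop, (c L).errorProb k d ≤ 1 / 4 :=
    (hc k d).eventually_le_const (by norm_num)
  filter_upwards [hsmall 0, hsmall 1, eventually_gt_atTop 0] with L h0 h1 hL
  have hL' : (0 : ℝ) < L := Nat.cast_pos.2 hL
  have he : ∀ k, (c L).errorProb k d ≤ 1 / 4 := Fin.forall_fin_two.2 ⟨h0, h1⟩
  have b1 : (L : ℝ) ≤ n.d3 * (c L).TE d + 1 := by exact_mod_cast (c L).length_le_d3 d he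
  have b2 : (L : ℝ) ≤ max (n.d1 : ℝ) n.d2 * (c L).TE d + 1 := by
    exact_mod_cast (c L).length_le_max d he
  have b3 : 2 * (L : ℝ) ≤ max ((n.d1 : ℝ) + n.d3) n.d2 * (c L).TE d + 1 := by
    exact_mod_cast (c L).two_mul_length_le_max d hd he
  have b4 : 2 * (L : ℝ) ≤ ⌊μ * L⌋₊ + ⌊nF * (c L).TF d⌋₊ +
      max (n.d2 : ℝ) n.d3 * (c L).TE d + 1 := by
    exact_mod_cast (c L).two_mul_length_le_cache d hd he
  have b5 : (L : ℝ) ≤ ⌊μ * L⌋₊ + ⌊nF * (c L).TF d⌋₊ + n.d2 * (c L).TE d + 1 := by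
    exact_mod_cast (c L).length_le_cache d he
  have f1 : (⌊μ * L⌋₊ : ℝ) ≤ μ * L := Nat.floor_le (by positivity)
  have f2 : (⌊nF * (c L).TF d⌋₊ : ℝ) ≤ nF * (c L).TF d := Nat.floor_le (by positivity)
  have h2 : (1 : ℝ) ≤ n.d2 := by exact_mod_cast hd2
  have h3 : (1 : ℝ) ≤ n.d3 := by exact_mod_cast hd3
  -- Every coefficient of `TE` is at least 1, so one extra channel use absorbs the additive bit.
  have hLB : n.ΔLB' * L ≤ (c L).TE d + 1 := by
    rw [n.ΔLB'_mul_le_iff hd2 hd3 hL'.le]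
    have m1 : 1 ≤ max (n.d1 : ℝ) n.d2 := h2.trans (le_max_right _ _)
    have m2 : 1 ≤ max ((n.d1 : ℝ) + n.d3) n.d2 := h2.trans (le_max_right _ _)
    refine ⟨?_, ?_, ?_⟩ <;> rw [mul_add, mul_one] <;> linarith
  have key := h L ((c L).TF d) ((c L).TE d) hL'.le (Nat.cast_nonneg _) (Nat.cast_nonneg _) hLB
    (by linarith) (by linarith)
  refine EReal.coe_le_coe_iff.2 ?_
  rw [le_div_iff₀ hL', add_mul, div_mul_cancel₀ _ hL'.ne']
  linarith

/-- The delivery times that meet the rate constraints are achievable. -/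
theorem minDTB_le (hd2 : 0 < n.d2) (hd3 : 0 < n.d3) (hμ1 : μ ≤ 1) (hnF : 0 ≤ nF)
    {τF τE : ℝ} (hF : 0 ≤ τF) (hE : n.ΔLB' ≤ τE)
    (h₂ : 2 - μ ≤ nF * τF + max (n.d2 : ℝ) n.d3 * τE) (h₁ : 1 - μ ≤ nF * τF + n.d2 * τE) :
    minDTB N μ nF n ≤ ((τE + τF : ℝ) : EReal) := by
  have hE0 : 0 ≤ τE := (n.ΔLB'_pos hd3).le.trans hE
  have h2 : (1 : ℝ) ≤ n.d2 := by exact_mod_cast hd2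
  -- The two extra uses make up for the two floors, each of which loses less than one bit.
  have hex (L : ℕ) : ∃ c : Code N μ nF n L, (∀ d, c.TF d = ⌈τF * L⌉₊) ∧
      (∀ d, c.TE d = ⌈τE * L⌉₊ + 2) ∧ ∀ k d, c.errorProb k d = 0 := by
    have hL : (0 : ℝ) ≤ L := L.cast_nonneg
    have e1 : τF * L ≤ (⌈τF * L⌉₊ : ℝ) := Nat.le_ceil _
    have e2 : τE * L + 2 ≤ ((⌈τE * L⌉₊ + 2 : ℕ) : ℝ) := by
      push_cast
      linarith [Nat.le_ceil (τE * L)]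
    have f1 := Nat.sub_one_lt_floor (μ * L)
    have f2 := Nat.sub_one_lt_floor (nF * ⌈τF * L⌉₊)
    have f3 : nF * (τF * L) ≤ nF * ⌈τF * L⌉₊ := mul_le_mul_of_nonneg_left e1 hnF
    have hLB : n.ΔLB' * L ≤ ((⌈τE * L⌉₊ + 2 : ℕ) : ℝ) := by
      have := mul_le_mul_of_nonneg_right hE hL
      linarith
    obtain ⟨a1, a2, a3⟩ := (n.ΔLB'_mul_le_iff hd2 hd3 hL _).1 hLB
    have slack {m : ℝ} (hm : 1 ≤ m) :
        m * τE * L + 2 ≤ m * ((⌈τE * L⌉₊ + 2 : ℕ) : ℝ) := by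
      have := mul_le_mul_of_nonneg_left e2 (zero_le_one.trans hm)
      linarith
    have s2 := slack h2
    have s3 := slack (h2.trans (le_max_left (n.d2 : ℝ) n.d3))
    have g2 := mul_le_mul_of_nonneg_right h₂ hL
    have g1 := mul_le_mul_of_nonneg_right h₁ hL
    have a4 : 2 * (L : ℝ) ≤ ⌊μ * L⌋₊ + ⌊nF * ⌈τF * L⌉₊⌋₊ +
        max (n.d2 : ℝ) n.d3 * ((⌈τE * L⌉₊ + 2 : ℕ) : ℝ) := by linarith
    have a5 : (L : ℝ) ≤ ⌊μ * L⌋₊ + ⌊nF * ⌈τF * L⌉₊⌋₊ +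
        n.d2 * ((⌈τE * L⌉₊ + 2 : ℕ) : ℝ) := by linarith
    exact Code.exists_of_le hμ1 _ _ (by exact_mod_cast a1) (by exact_mod_cast a2)
      (by exact_mod_cast a3) (by exact_mod_cast a4) (by exact_mod_cast a5)
  choose c hTF hTE hc using hex
  have hle : minDTB N μ nF n ≤ Scheme.dtb c := sInf_le ⟨c, fun k d => by simp [hc], rfl⟩
  refine hle.trans (iSup_le fun d => ?_)
  rw [← (tendsto_add_div_coe (τE + τF) 4).limsup_eq]
  refine limsup_le_limsup ?_
  filter_upwards [eventually_gt_atTop 0] with L hL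
  have hL' : (0 : ℝ) < L := Nat.cast_pos.2 hL
  refine EReal.coe_le_coe_iff.2 ?_
  rw [hTF, hTE, div_le_iff₀ hL', add_mul _ (4 / (L : ℝ)), div_mul_cancel₀ _ hL'.ne']
  push_cast
  have := Nat.ceil_lt_add_one (mul_nonneg hF hL'.le)
  have := Nat.ceil_lt_add_one (mul_nonneg hE0 hL'.le)
  linarith

theorem minDTB_le_of_pos (hd2 : 0 < n.d2) (hd3 : 0 < n.d3) (hμ1 : μ ≤ 1)
    (hnF : 0 < nF) {τE : ℝ} (hE : n.ΔLB' ≤ τE) :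
    minDTB N μ nF n ≤ ((max ((2 - μ) / nF + (1 - max (n.d2 : ℝ) n.d3 / nF) * τE)
      (max ((1 - μ) / nF + (1 - (n.d2 : ℝ) / nF) * τE) τE) : ℝ) : EReal) := by
  -- The least nonnegative fronthaul time meeting both cache constraints for the given `τE`.
  obtain ⟨τF, hτF⟩ : ∃ τF, τF = max ((2 - μ - max (n.d2 : ℝ) n.d3 * τE) / nF)
    (max ((1 - μ - n.d2 * τE) / nF) 0) := ⟨_, rfl⟩
  have t2 : (2 - μ - max (n.d2 : ℝ) n.d3 * τE) / nF ≤ τF := hτF ▸ le_max_left _ _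
  have t1 : (1 - μ - n.d2 * τE) / nF ≤ τF := hτF ▸ (le_max_left _ _).trans (le_max_right _ _)
  have t0 : 0 ≤ τF := hτF ▸ (le_max_right _ _).trans (le_max_right _ _)
  rw [div_le_iff₀' hnF] at t2 t1
  refine (minDTB_le hd2 hd3 hμ1 hnF.le t0 hE (by linarith) (by linarith)).trans
    (EReal.coe_le_coe_iff.2 (le_of_eq ?_))
  rw [hτF, ← max_add_add_left, ← max_add_add_left, add_zero]
  congr 1
  · ring
  · congr 1
    ring

/-! ### Lower bounds by combining constraints. -/

theorem coe_max_le {a b : ℝ} {x : EReal} (ha : (a : EReal) ≤ x) (hb : (b : EReal) ≤ x) :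
    ((max a b : ℝ) : EReal) ≤ x := by
  rcases max_choice a b with h | h <;> rwa [h]

theorem ΔLB'_le_minDTB (hN : 2 ≤ N) (hd2 : 0 < n.d2) (hd3 : 0 < n.d3) (hμ0 : 0 ≤ μ)
    (hnF : 0 ≤ nF) :
    (n.ΔLB' : EReal) ≤ minDTB N μ nF n :=
  le_minDTB hN hd2 hd3 hμ0 hnF _ 1 fun L tF tE _ _ _ h _ _ => by linarith

theorem one_sub_div_le_minDTB (hN : 2 ≤ N) (hd2 : 0 < n.d2) (hd3 : 0 < n.d3) (hμ0 : 0 ≤ μ)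
    (hnF : 0 ≤ nF) (h : nF ≤ n.d2) :
    (((1 - μ) / n.d2 : ℝ) : EReal) ≤ minDTB N μ nF n := by
  have h2 : (1 : ℝ) ≤ n.d2 := by exact_mod_cast hd2
  refine le_minDTB hN hd2 hd3 hμ0 hnF _ 1 fun L tF tE _ hF _ _ _ h1 => ?_
  rw [div_mul_eq_mul_div, div_le_iff₀ (by linarith)]
  have := mul_le_mul_of_nonneg_right h hF
  linarith

theorem two_sub_div_le_minDTB (hN : 2 ≤ N) (hd2 : 0 < n.d2) (hd3 : 0 < n.d3) (hμ0 : 0 ≤ μ)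
    (hnF : 0 ≤ nF) (h : nF ≤ max (n.d2 : ℝ) n.d3) :
    (((2 - μ) / max (n.d2 : ℝ) n.d3 : ℝ) : EReal) ≤ minDTB N μ nF n := by
  have h2 : (1 : ℝ) ≤ max (n.d2 : ℝ) n.d3 := le_max_of_le_left (by exact_mod_cast hd2)
  refine le_minDTB hN hd2 hd3 hμ0 hnF _ 1 fun L tF tE _ hF _ _ h1 _ => ?_
  rw [div_mul_eq_mul_div, div_le_iff₀ (by linarith)]
  have := mul_le_mul_of_nonneg_right h hF
  linarith

theorem one_sub_add_le_minDTB (hN : 2 ≤ N) (hd2 : 0 < n.d2) (hd3 : 0 < n.d3) (hμ0 : 0 ≤ μ)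
    (h : n.d2 ≤ nF) :
    (((1 - μ) / nF + (1 - n.d2 / nF) * n.ΔLB' : ℝ) : EReal) ≤ minDTB N μ nF n := by
  have h2 : (1 : ℝ) ≤ n.d2 := by exact_mod_cast hd2
  have hpos : 0 < nF := by linarith
  refine le_minDTB hN hd2 hd3 hμ0 hpos.le _ 2 fun L tF tE _ hF _ h0 _ h1 => ?_
  have e : ((1 - μ) / nF + (1 - n.d2 / nF) * n.ΔLB') * L =
      ((1 - μ) * L + (nF - n.d2) * (n.ΔLB' * L)) / nF := by
    field_simp
  rw [e, div_le_iff₀ hpos]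
  have := mul_le_mul_of_nonneg_left h0 (sub_nonneg.2 h)
  linarith

theorem two_sub_add_le_minDTB (hN : 2 ≤ N) (hd2 : 0 < n.d2) (hd3 : 0 < n.d3) (hμ0 : 0 ≤ μ)
    (h : max (n.d2 : ℝ) n.d3 ≤ nF) :
    (((2 - μ) / nF + (1 - max (n.d2 : ℝ) n.d3 / nF) * n.ΔLB' : ℝ) : EReal) ≤
      minDTB N μ nF n := by
  have h2 : (1 : ℝ) ≤ max (n.d2 : ℝ) n.d3 := le_max_of_le_left (by exact_mod_cast hd2)
  have hpos : 0 < nF := by linarith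
  refine le_minDTB hN hd2 hd3 hμ0 hpos.le _ 2 fun L tF tE _ hF _ h0 h1 _ => ?_
  have e : ((2 - μ) / nF + (1 - max (n.d2 : ℝ) n.d3 / nF) * n.ΔLB') * L =
      ((2 - μ) * L + (nF - max (n.d2 : ℝ) n.d3) * (n.ΔLB' * L)) / nF := by
    field_simp
  rw [e, div_le_iff₀ hpos]
  have := mul_le_mul_of_nonneg_left h0 (sub_nonneg.2 h)
  linarith

/-- Weights d3 - nF and nF - d2 on the (1 - μ) and (2 - μ) constraints give both times the same
coefficient nF (d3 - d2). The two constraints are jointly tight at τE = 1 / (d3 - d2). -/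
theorem one_sub_add_one_div_le_minDTB (hN : 2 ≤ N) (hd2 : 0 < n.d2) (hd3 : 0 < n.d3) (hμ0 : 0 ≤ μ)
    (h : n.d2 ≤ nF) (h' : nF ≤ n.d3) (hlt : n.d2 < n.d3) :
    (((1 - μ) / nF + (1 - n.d2 / nF) * (1 / ((n.d3 : ℝ) - n.d2)) : ℝ) : EReal) ≤
      minDTB N μ nF n := by
  have h2 : (1 : ℝ) ≤ n.d2 := by exact_mod_cast hd2
  have hlt' : (n.d2 : ℝ) < n.d3 := by exact_mod_cast hlt
  have hsub : 0 < (n.d3 : ℝ) - n.d2 := sub_pos.2 hlt'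
  have hpos : 0 < nF := by linarith
  refine le_minDTB hN hd2 hd3 hμ0 hpos.le _ 1 fun L tF tE _ hF _ _ h1 h0 => ?_
  rw [max_eq_right hlt'.le] at h1
  have e : ((1 - μ) / nF + (1 - n.d2 / nF) * (1 / ((n.d3 : ℝ) - n.d2))) * L =
      ((n.d3 - nF) * ((1 - μ) * L) + (nF - n.d2) * ((2 - μ) * L)) / (nF * (n.d3 - n.d2)) := by
    have := hsub.ne'
    field_simp
    ring
  rw [e, div_le_iff₀ (by positivity)]
  have k1 := mul_le_mul_of_nonneg_left h0 (sub_nonneg.2 h')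
  have k2 := mul_le_mul_of_nonneg_left h1 (sub_nonneg.2 h)
  have k3 := mul_le_mul_of_nonneg_right (h2.trans h) hsub.le
  linarith

/-! ### Closed forms in the three fronthaul ranges. -/

theorem minDTB_of_le_d2 (hN : 2 ≤ N) (hd2 : 0 < n.d2) (hd3 : 0 < n.d3) (hμ0 : 0 ≤ μ)
    (hμ1 : μ ≤ 1) (hnF : 0 ≤ nF) (h : nF ≤ n.d2) :
    minDTB N μ nF n = ((max ((1 - μ) / (n.d2 : ℝ))
      (max ((2 - μ) / max (n.d2 : ℝ) (n.d3 : ℝ)) n.ΔLB') : ℝ) : EReal) := by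
  have h2 : (0 : ℝ) < n.d2 := Nat.cast_pos.2 hd2
  refine le_antisymm ?_ (coe_max_le (one_sub_div_le_minDTB hN hd2 hd3 hμ0 hnF h)
    (coe_max_le (two_sub_div_le_minDTB hN hd2 hd3 hμ0 hnF (h.trans (le_max_left _ _)))
      (ΔLB'_le_minDTB hN hd2 hd3 hμ0 hnF)))
  set v := max ((1 - μ) / (n.d2 : ℝ)) (max ((2 - μ) / max (n.d2 : ℝ) (n.d3 : ℝ)) n.ΔLB')
  have v1 : (1 - μ) / (n.d2 : ℝ) ≤ v := le_max_left _ _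
  have v2 : (2 - μ) / max (n.d2 : ℝ) (n.d3 : ℝ) ≤ v := (le_max_left _ _).trans (le_max_right _ _)
  have v3 : n.ΔLB' ≤ v := (le_max_right _ _).trans (le_max_right _ _)
  rw [div_le_iff₀' h2] at v1
  rw [div_le_iff₀' (lt_max_of_lt_left h2)] at v2
  simpa using minDTB_le hd2 hd3 hμ1 hnF le_rfl v3 (by linarith) (by linarith)

theorem minDTB_of_max_le (hN : 2 ≤ N) (hd2 : 0 < n.d2) (hd3 : 0 < n.d3) (hμ0 : 0 ≤ μ)
    (hμ1 : μ ≤ 1) (h : max (n.d2 : ℝ) (n.d3 : ℝ) ≤ nF) :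
    minDTB N μ nF n = ((max ((2 - μ) / nF + (1 - max (n.d2 : ℝ) (n.d3 : ℝ) / nF) * n.ΔLB')
      (max ((1 - μ) / nF + (1 - (n.d2 : ℝ) / nF) * n.ΔLB') n.ΔLB') : ℝ) : EReal) := by
  have h2 : (0 : ℝ) < n.d2 := Nat.cast_pos.2 hd2
  have h' := (le_max_left _ _).trans h
  have hpos : 0 < nF := h2.trans_le h'
  exact le_antisymm (minDTB_le_of_pos hd2 hd3 hμ1 hpos le_rfl)
    (coe_max_le (two_sub_add_le_minDTB hN hd2 hd3 hμ0 h)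
      (coe_max_le (one_sub_add_le_minDTB hN hd2 hd3 hμ0 h')
        (ΔLB'_le_minDTB hN hd2 hd3 hμ0 hpos.le)))

theorem div_add_mul_le_iff {a m x v : ℝ} (h : 0 < nF) :
    a / nF + (1 - m / nF) * x ≤ v ↔ a + (nF - m) * x ≤ v * nF := by
  rw [← div_le_iff₀ h]
  have : a / nF + (1 - m / nF) * x = (a + (nF - m) * x) / nF := by
    field_simp
  rw [this]

theorem minDTB_of_between (hN : 2 ≤ N) (hd2 : 0 < n.d2) (hd3 : 0 < n.d3) (hμ0 : 0 ≤ μ)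
    (hμ1 : μ ≤ 1) (h : n.d2 ≤ nF) (h' : nF ≤ max (n.d2 : ℝ) (n.d3 : ℝ)) :
    minDTB N μ nF n = ((max ((1 - μ) / nF + (1 - (n.d2 : ℝ) / nF) * n.ΔLB'')
      (max ((2 - μ) / max (n.d2 : ℝ) (n.d3 : ℝ)) n.ΔLB') : ℝ) : EReal) := by
  have h2 : (0 : ℝ) < n.d2 := Nat.cast_pos.2 hd2
  have hpos : 0 < nF := h2.trans_le h
  rcases le_or_gt n.d3 n.d2 with h32 | h32
  -- The range shrinks to nF = d2, where the factor of `ΔLB''` vanishes.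
  · have hmax : max (n.d2 : ℝ) n.d3 = n.d2 := max_eq_left (Nat.cast_le.2 h32)
    have e : nF = n.d2 := le_antisymm (hmax ▸ h') h
    rw [minDTB_of_le_d2 hN hd2 hd3 hμ0 hμ1 hpos.le e.le, e, div_self h2.ne', sub_self, zero_mul,
      add_zero]
  have h32' : (n.d2 : ℝ) < n.d3 := Nat.cast_lt.2 h32
  have hsub : 0 < (n.d3 : ℝ) - n.d2 := sub_pos.2 h32'
  have hmax : max (n.d2 : ℝ) n.d3 = n.d3 := max_eq_right h32'.le
  refine le_antisymm ?_ (coe_max_le ?_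
    (coe_max_le (two_sub_div_le_minDTB hN hd2 hd3 hμ0 hpos.le h')
      (ΔLB'_le_minDTB hN hd2 hd3 hμ0 hpos.le)))
  · rcases le_total (1 / ((n.d3 : ℝ) - n.d2)) n.ΔLB' with hΔ | hΔ
    -- At τE = `ΔLB'` the (1 - μ) constraint implies the (2 - μ) one, since (d3 - d2) `ΔLB'` ≥ 1.
    · rw [Channel.ΔLB'', max_eq_right hΔ]
      refine (minDTB_le_of_pos hd2 hd3 hμ1 hpos le_rfl).trans (EReal.coe_le_coe_iff.2 ?_)
      rw [div_le_iff₀' hsub] at hΔ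
      rw [hmax]
      refine max_le ((?_ : _ ≤ _).trans (le_max_left _ _))
        (max_le (le_max_left _ _) ((le_max_right _ _).trans (le_max_right _ _)))
      rw [div_add_mul_le_iff hpos]
      have e : ((1 - μ) / nF + (1 - (n.d2 : ℝ) / nF) * n.ΔLB') * nF =
          1 - μ + (nF - n.d2) * n.ΔLB' := by field_simp
      rw [e]
      linarith
    · rw [Channel.ΔLB'', max_eq_left hΔ, hmax]
      have hone : (n.d3 - n.d2) * (1 / ((n.d3 : ℝ) - n.d2)) = 1 := mul_one_div_cancel hsub.ne'
      generalize 1 / ((n.d3 : ℝ) - n.d2) = E at hΔ hone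
      rcases le_total (n.d2 * E) (1 - μ) with hE | hE
      -- The vertex where both cache constraints are tight has τF ≥ 0, so it is feasible.
      · refine (minDTB_le_of_pos hd2 hd3 hμ1 hpos hΔ).trans (EReal.coe_le_coe_iff.2 ?_)
        have e : ((1 - μ) / nF + (1 - (n.d2 : ℝ) / nF) * E) * nF =
            1 - μ + (nF - n.d2) * E := by field_simp
        rw [hmax]
        refine (max_le ?_ (max_le le_rfl ?_)).trans (le_max_left _ _)
        · rw [div_add_mul_le_iff hpos, e]
          linarith
        · rw [← mul_le_mul_iff_left₀ hpos, e]
          linarith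
      -- Here that vertex would need τF ≤ 0, so the fronthaul stays idle, and the (2 - μ) constraint
      -- implies the (1 - μ) one.
      · have hle : 1 - μ ≤ n.d2 * ((2 - μ) / n.d3) := by
          rw [mul_div_assoc', le_div_iff₀ (h2.trans h32')]
          have := mul_le_mul_of_nonneg_left hE hsub.le
          have e : ((n.d3 : ℝ) - n.d2) * (n.d2 * E) = n.d2 := by
            rw [mul_left_comm, hone, mul_one]
          rw [e] at this
          linarith
        have hB := le_max_left ((2 - μ) / (n.d3 : ℝ)) n.ΔLB'
        have hB2 := mul_le_mul_of_nonneg_left hB h2.le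
        have hB3 := (div_le_iff₀' (h2.trans h32')).1 hB
        refine (minDTB_le hd2 hd3 hμ1 hpos.le le_rfl
          (le_max_right ((2 - μ) / (n.d3 : ℝ)) n.ΔLB')
          (by rw [hmax]; linarith) (by linarith)).trans (EReal.coe_le_coe_iff.2 ?_)
        rw [add_zero]
        exact le_max_right _ _
  · rw [Channel.ΔLB'']
    rcases max_choice (1 / ((n.d3 : ℝ) - n.d2)) n.ΔLB' with e | e <;> rw [e]
    · exact one_sub_add_one_div_le_minDTB hN hd2 hd3 hμ0 h (hmax ▸ h') h32
    · exact one_sub_add_le_minDTB hN hd2 hd3 hμ0 h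

/-! ### The four classes: dominated terms. -/

theorem minDTB_classI (hN : 2 ≤ N) (hd2 : 0 < n.d2) (hd3 : 0 < n.d3) (hμ0 : 0 ≤ μ)
    (hμ1 : μ ≤ 1) (hnF : 0 ≤ nF) (hn : n.ClassI) :
    (nF ≤ max (n.d2 : ℝ) (n.d3 : ℝ) → minDTB N μ nF n =
      ((max ((2 - μ) / max (n.d2 : ℝ) (n.d3 : ℝ)) n.ΔLB' : ℝ) : EReal)) ∧
    (max (n.d2 : ℝ) (n.d3 : ℝ) ≤ nF → minDTB N μ nF n =
      ((max ((2 - μ) / nF + (1 - max (n.d2 : ℝ) (n.d3 : ℝ) / nF) * n.ΔLB')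
        n.ΔLB' : ℝ) : EReal)) := by
  have h2 : (0 : ℝ) < n.d2 := Nat.cast_pos.2 hd2
  have h3 : (0 : ℝ) < n.d3 := Nat.cast_pos.2 hd3
  have hcases : (n.d3 : ℝ) ≤ n.d2 ∨ (n.d2 : ℝ) < n.d3 ∧ (n.d3 : ℝ) ≤ 2 * n.d2 := by
    rcases hn with ⟨⟨h, -⟩, -⟩ | ⟨h, h'⟩
    · exact Or.inl (Nat.cast_le.2 h)
    · rcases h.eq_or_lt with h | h
      · exact Or.inl (Nat.cast_le.2 h.ge)
      · exact Or.inr ⟨Nat.cast_lt.2 h, by exact_mod_cast h'⟩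
  have hA : (1 - μ) / (n.d2 : ℝ) ≤ (2 - μ) / max (n.d2 : ℝ) (n.d3 : ℝ) := by
    rw [div_le_div_iff₀ h2 (lt_max_of_lt_left h2)]
    rcases hcases with h | ⟨h, h'⟩
    · rw [max_eq_left h]
      nlinarith
    · rw [max_eq_right h.le]
      nlinarith
  refine ⟨fun h => ?_, fun h => ?_⟩
  · rcases le_total nF n.d2 with hF | hF
    · rw [minDTB_of_le_d2 hN hd2 hd3 hμ0 hμ1 hnF hF,
        max_eq_right (hA.trans (le_max_left _ _))]
    rw [minDTB_of_between hN hd2 hd3 hμ0 hμ1 hF h, max_eq_right]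
    have hpos := h2.trans_le hF
    rcases hcases with h32 | ⟨h32, h32'⟩
    · rw [max_eq_left h32] at h ⊢
      rw [le_antisymm h hF, div_self h2.ne', sub_self, zero_mul, add_zero]
      exact le_max_of_le_left (by gcongr; norm_num)
    · rw [max_eq_right h32.le] at h hA ⊢
      have hsub : 0 < (n.d3 : ℝ) - n.d2 := sub_pos.2 h32
      rw [Channel.ΔLB'']
      rcases max_choice (1 / ((n.d3 : ℝ) - n.d2)) n.ΔLB' with e | e <;> rw [e]
      · refine le_max_of_le_left ?_
        rw [div_add_mul_le_iff hpos, mul_one_div, div_mul_eq_mul_div, le_div_iff₀ h3, add_mul,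
          div_mul_eq_mul_div, ← le_sub_iff_add_le', div_le_iff₀ hsub]
        have := mul_nonneg (sub_nonneg.2 h)
          (show (0 : ℝ) ≤ (2 - μ) * n.d2 - (1 - μ) * n.d3 by nlinarith)
        nlinarith
      · have k1 := (div_le_iff₀ h2).1 (hA.trans (le_max_left _ n.ΔLB'))
        have k2 := mul_le_mul_of_nonneg_left (le_max_right ((2 - μ) / (n.d3 : ℝ)) n.ΔLB')
          (sub_nonneg.2 hF)
        rw [div_add_mul_le_iff hpos]
        linarith
  · have hpos : 0 < nF := (lt_max_of_lt_left h2).trans_le h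
    rw [minDTB_of_max_le hN hd2 hd3 hμ0 hμ1 h, ← max_assoc, max_comm ((2 - μ) / nF + _), max_assoc,
      max_eq_right]
    have e : ((2 - μ) / nF + (1 - max (n.d2 : ℝ) n.d3 / nF) * n.ΔLB') * nF =
        2 - μ + (nF - max (n.d2 : ℝ) n.d3) * n.ΔLB' := by field_simp
    rcases hcases with h32 | ⟨h32, h32'⟩
    · refine le_max_of_le_left ?_
      rw [div_add_mul_le_iff hpos, e, max_eq_left h32]
      linarith
    -- Either the (2 - μ) term dominates, or `ΔLB'` ≥ 1 / (d3 - d2) ≥ 1 / d2 and the (1 - μ) term is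
    -- at most `ΔLB'`.
    · rcases le_total ((n.d3 - n.d2) * n.ΔLB') 1 with h1 | h1
      · refine le_max_of_le_left ?_
        rw [div_add_mul_le_iff hpos, e, max_eq_right h32.le]
        linarith
      · refine le_max_of_le_right ?_
        rw [div_add_mul_le_iff hpos]
        have := n.ΔLB'_pos hd3
        nlinarith

theorem minDTB_classII (hN : 2 ≤ N) (hd2 : 0 < n.d2) (hd3 : 0 < n.d3) (hμ0 : 0 ≤ μ)
    (hμ1 : μ ≤ 1) (hnF : 0 ≤ nF) (hn : n.ClassII) :
    (nF ≤ (n.d2 : ℝ) → minDTB N μ nF n =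
      ((max ((1 - μ) / (n.d2 : ℝ)) (max ((2 - μ) / (n.d3 : ℝ)) n.ΔLB') : ℝ) : EReal)) ∧
    ((n.d2 : ℝ) ≤ nF → nF ≤ (n.d3 : ℝ) → minDTB N μ nF n =
      ((max ((1 - μ) / nF + (1 - (n.d2 : ℝ) / nF) * n.ΔLB'')
        (max ((2 - μ) / (n.d3 : ℝ)) n.ΔLB') : ℝ) : EReal)) ∧
    ((n.d3 : ℝ) ≤ nF → minDTB N μ nF n =
      ((max ((2 - μ) / nF + (1 - (n.d3 : ℝ) / nF) * n.ΔLB') n.ΔLB' : ℝ) : EReal)) := by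
  obtain ⟨⟨-, h23⟩, hΔ, -⟩ := hn
  have h3 : (0 : ℝ) < n.d3 := Nat.cast_pos.2 hd3
  have h32 : (n.d2 : ℝ) < n.d3 := Nat.cast_lt.2 (by omega)
  have hmax : max (n.d2 : ℝ) n.d3 = n.d3 := max_eq_right h32.le
  rw [le_div_iff₀' (sub_pos.2 h32)] at hΔ
  refine ⟨fun h => ?_, fun h h' => ?_, fun h => ?_⟩
  · rw [minDTB_of_le_d2 hN hd2 hd3 hμ0 hμ1 hnF h, hmax]
  · rw [minDTB_of_between hN hd2 hd3 hμ0 hμ1 h (hmax.symm ▸ h'), hmax]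
  · have hpos : 0 < nF := h3.trans_le h
    rw [minDTB_of_max_le hN hd2 hd3 hμ0 hμ1 (hmax.symm ▸ h), hmax, ← max_assoc,
      max_eq_left (b := (1 - μ) / nF + (1 - (n.d2 : ℝ) / nF) * n.ΔLB')]
    have e : ((2 - μ) / nF + (1 - (n.d3 : ℝ) / nF) * n.ΔLB') * nF =
        2 - μ + (nF - n.d3) * n.ΔLB' := by field_simp
    rw [div_add_mul_le_iff hpos, e]
    linarith

/-- The (2 - μ) constraint is redundant: it is the (1 - μ) constraint plus (d3 - d2) τE ≥ 1, which
τE ≥ `ΔLB'` ensures. -/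
theorem minDTB_classIII (hN : 2 ≤ N) (hd2 : 0 < n.d2) (hd3 : 0 < n.d3) (hμ0 : 0 ≤ μ)
    (hμ1 : μ ≤ 1) (hnF : 0 ≤ nF) (hn : n.ClassIII) :
    (nF ≤ (n.d2 : ℝ) → minDTB N μ nF n =
      ((max ((1 - μ) / (n.d2 : ℝ)) n.ΔLB' : ℝ) : EReal)) ∧
    ((n.d2 : ℝ) ≤ nF → minDTB N μ nF n =
      ((max ((1 - μ) / nF + (1 - (n.d2 : ℝ) / nF) * n.ΔLB') n.ΔLB' : ℝ) : EReal)) := by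
  obtain ⟨⟨-, h23⟩, hΔ, -⟩ := hn
  have h2 : (0 : ℝ) < n.d2 := Nat.cast_pos.2 hd2
  have h3 : (0 : ℝ) < n.d3 := Nat.cast_pos.2 hd3
  have h32 : (n.d2 : ℝ) < n.d3 := Nat.cast_lt.2 (by omega)
  have hmax : max (n.d2 : ℝ) n.d3 = n.d3 := max_eq_right h32.le
  have hΔ' := hΔ
  rw [div_le_iff₀' (sub_pos.2 h32)] at hΔ
  refine ⟨fun h => ?_, fun h => ?_⟩
  · rw [minDTB_of_le_d2 hN hd2 hd3 hμ0 hμ1 hnF h, hmax, ← max_assoc,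
      max_comm ((1 - μ) / (n.d2 : ℝ)), max_assoc, max_eq_right]
    have k1 := (div_le_iff₀' h2).1 (le_max_left ((1 - μ) / (n.d2 : ℝ)) n.ΔLB')
    have k2 := mul_le_mul_of_nonneg_left (le_max_right ((1 - μ) / (n.d2 : ℝ)) n.ΔLB')
      (sub_nonneg.2 h32.le)
    rw [div_le_iff₀' h3]
    linarith
  · have hpos : 0 < nF := h2.trans_le h
    rcases le_total nF n.d3 with h' | h'
    · rw [minDTB_of_between hN hd2 hd3 hμ0 hμ1 h (hmax.symm ▸ h'), hmax, Channel.ΔLB'',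
        max_eq_right hΔ', ← max_assoc, max_comm ((1 - μ) / nF + _), max_assoc, max_eq_right]
      have k1 := (div_add_mul_le_iff hpos).1
        (le_max_left ((1 - μ) / nF + (1 - (n.d2 : ℝ) / nF) * n.ΔLB') n.ΔLB')
      have k2 := mul_le_mul_of_nonneg_left
        (le_max_right ((1 - μ) / nF + (1 - (n.d2 : ℝ) / nF) * n.ΔLB') n.ΔLB') (sub_nonneg.2 h')
      rw [div_le_iff₀' h3]
      linarith
    · rw [minDTB_of_max_le hN hd2 hd3 hμ0 hμ1 (hmax.symm ▸ h'), hmax, max_eq_right]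
      refine le_max_of_le_left ?_
      have e : ((1 - μ) / nF + (1 - (n.d2 : ℝ) / nF) * n.ΔLB') * nF =
          1 - μ + (nF - n.d2) * n.ΔLB' := by field_simp
      rw [div_add_mul_le_iff hpos, e]
      linarith

theorem minDTB_classIV (hN : 2 ≤ N) (hd2 : 0 < n.d2) (hd3 : 0 < n.d3) (hμ0 : 0 ≤ μ)
    (hμ1 : μ ≤ 1) (hnF : 0 ≤ nF) (hn : n.ClassIV) : minDTB N μ nF n = ((n.ΔLB' : ℝ) : EReal) := by
  have h2 : (0 : ℝ) < n.d2 := Nat.cast_pos.2 hd2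
  have h3 : (0 : ℝ) < n.d3 := Nat.cast_pos.2 hd3
  have hpos := n.ΔLB'_pos hd3
  -- At τE = `ΔLB'` both cache constraints hold even without cache and fronthaul.
  have key : 1 ≤ n.d2 * n.ΔLB' ∧ 2 ≤ max (n.d2 : ℝ) n.d3 * n.ΔLB' := by
    have hm := mul_le_mul_of_nonneg_right (le_max_left (n.d2 : ℝ) n.d3) hpos.le
    obtain ⟨a1, -, a3⟩ := (n.ΔLB'_mul_le_iff hd2 hd3 zero_le_one n.ΔLB').1 (mul_one _).le
    rcases hn with (⟨-, h⟩ | h) | ⟨⟨-, h⟩, hΔ⟩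
    · have h' : 2 * (n.d3 : ℝ) ≤ n.d2 := by exact_mod_cast h
      have := mul_le_mul_of_nonneg_right h' hpos.le
      constructor <;> linarith
    · have h' : (n.d1 : ℝ) + n.d3 ≤ n.d2 := by exact_mod_cast h
      rw [max_eq_right h'] at a3
      constructor <;> linarith
    · have h' : 2 * (n.d2 : ℝ) ≤ n.d3 := by exact_mod_cast h
      rw [div_le_iff₀' h2] at hΔ
      have := mul_le_mul_of_nonneg_right (h'.trans (le_max_right (n.d2 : ℝ) n.d3)) hpos.le
      constructor <;> linarith
  refine le_antisymm ?_ (ΔLB'_le_minDTB hN hd2 hd3 hμ0 hnF)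
  simpa using minDTB_le hd2 hd3 hμ1 hnF le_rfl le_rfl (by linarith [key.2])
    (by linarith [key.1])

end HetNet

theorem theorem1 (N : ℕ) (hN : 2 ≤ N) (n : HetNet.Channel) (hd2 : 0 < n.d2) (hd3 : 0 < n.d3)
    (μ : ℝ) (hμ0 : 0 ≤ μ) (hμ1 : μ ≤ 1) (nF : ℝ) (hnF : 0 ≤ nF) :
    -- the delivery time per bit in the three ranges of the fronthaul capacity
    ((nF ≤ (n.d2 : ℝ) →
        HetNet.minDTB N μ nF n =
          ((max ((1 - μ) / (n.d2 : ℝ))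
            (max ((2 - μ) / max (n.d2 : ℝ) (n.d3 : ℝ)) n.ΔLB') : ℝ) : EReal)) ∧
      ((n.d2 : ℝ) ≤ nF → nF ≤ max (n.d2 : ℝ) (n.d3 : ℝ) →
        HetNet.minDTB N μ nF n =
          ((max ((1 - μ) / nF + (1 - (n.d2 : ℝ) / nF) * n.ΔLB'')
            (max ((2 - μ) / max (n.d2 : ℝ) (n.d3 : ℝ)) n.ΔLB') : ℝ) : EReal)) ∧
      (max (n.d2 : ℝ) (n.d3 : ℝ) ≤ nF →
        HetNet.minDTB N μ nF n =
          ((max ((2 - μ) / nF + (1 - max (n.d2 : ℝ) (n.d3 : ℝ) / nF) * n.ΔLB')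
            (max ((1 - μ) / nF + (1 - (n.d2 : ℝ) / nF) * n.ΔLB') n.ΔLB') : ℝ) : EReal))) ∧
    -- Class I
    (n.ClassI →
      (nF ≤ max (n.d2 : ℝ) (n.d3 : ℝ) →
        HetNet.minDTB N μ nF n =
          ((max ((2 - μ) / max (n.d2 : ℝ) (n.d3 : ℝ)) n.ΔLB' : ℝ) : EReal)) ∧
      (max (n.d2 : ℝ) (n.d3 : ℝ) ≤ nF →
        HetNet.minDTB N μ nF n =
          ((max ((2 - μ) / nF + (1 - max (n.d2 : ℝ) (n.d3 : ℝ) / nF) * n.ΔLB')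
            n.ΔLB' : ℝ) : EReal))) ∧
    -- Class II
    (n.ClassII →
      (nF ≤ (n.d2 : ℝ) →
        HetNet.minDTB N μ nF n =
          ((max ((1 - μ) / (n.d2 : ℝ)) (max ((2 - μ) / (n.d3 : ℝ)) n.ΔLB') : ℝ) : EReal)) ∧
      ((n.d2 : ℝ) ≤ nF → nF ≤ (n.d3 : ℝ) →
        HetNet.minDTB N μ nF n =
          ((max ((1 - μ) / nF + (1 - (n.d2 : ℝ) / nF) * n.ΔLB'')
            (max ((2 - μ) / (n.d3 : ℝ)) n.ΔLB') : ℝ) : EReal)) ∧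
      ((n.d3 : ℝ) ≤ nF →
        HetNet.minDTB N μ nF n =
          ((max ((2 - μ) / nF + (1 - (n.d3 : ℝ) / nF) * n.ΔLB') n.ΔLB' : ℝ) : EReal))) ∧
    -- Class III
    (n.ClassIII →
      (nF ≤ (n.d2 : ℝ) →
        HetNet.minDTB N μ nF n = ((max ((1 - μ) / (n.d2 : ℝ)) n.ΔLB' : ℝ) : EReal)) ∧
      ((n.d2 : ℝ) ≤ nF →
        HetNet.minDTB N μ nF n =
          ((max ((1 - μ) / nF + (1 - (n.d2 : ℝ) / nF) * n.ΔLB') n.ΔLB' : ℝ) : EReal))) ∧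
    -- Class IV
    (n.ClassIV → HetNet.minDTB N μ nF n = ((n.ΔLB' : ℝ) : EReal)) := by
  exact ⟨⟨HetNet.minDTB_of_le_d2 hN hd2 hd3 hμ0 hμ1 hnF,
      HetNet.minDTB_of_between hN hd2 hd3 hμ0 hμ1,
      HetNet.minDTB_of_max_le hN hd2 hd3 hμ0 hμ1⟩,
    HetNet.minDTB_classI hN hd2 hd3 hμ0 hμ1 hnF, HetNet.minDTB_classII hN hd2 hd3 hμ0 hμ1 hnF,
    HetNet.minDTB_classIII hN hd2 hd3 hμ0 hμ1 hnF, HetNet.minDTB_classIV hN hd2 hd3 hμ0 hμ1 hnF⟩
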